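/- Let $\mathbb K$ be $\mathbb R$ or $\mathbb C$, let $U\subseteq\mathbb K^4$ be open with coordinates $x^1,\dots,x^4$, and let smooth mean $C^\infty$ over $\mathbb K$ (holomorphic if $\mathbb K=\mathbb C$). Let $A_1,\dots,A_4$ be smooth vector fields and $f$ a smooth nowhere vanishing function on $U$ satisfying the self-dual Einstein equations: $X(\lambda)=A_1+\lambda A_2$ and $Y(\lambda)=A_3+\lambda A_4$ commute for all $\lambda\in\mathbb K$, and $\sum_i\partial_{x^i}(fA^i_\alpha)=0$ for $\alpha=1,\dots,4$. A smooth function $\Phi$ is called an eigenfunction for the parameter $\lambda$ if $X(\lambda)\Phi=Y(\lambda)\Phi=0$. Let $\lambda_1,\dots,\lambda_4\in\mathbb K$ be distinct and let $\phi^1,\dots,\phi^4$ be eigenfunctions on $U$ for $\lambda_1,\dots,\lambda_4$ respectively, functionally independent in the sense that $J=\det(\partial\phi^i/\partial x^k)\neq0$ on $U$. Let $\partial_{y^k}$ denote the partial derivatives with respect to the local coordinates $y^i=\phi^i$. With the Levi-Civita symbol $\epsilon$, put $$A^{lm}=\frac fJ\bigl[(A_4\phi^l)(A_2\phi^m)-(A_2\phi^l)(A_4\phi^m)\bigr],\qquad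 \Omega_k=\frac14\sum_{i\ne k}\sum_{l,m}\epsilon_{iklm}\frac{A^{lm}}{\lambda_k-\lambda_i}\,d\phi^i\wedge d\phi^k .$$ 1. Locally (in a neighbourhood of each point of $U$) there exist smooth functions $\psi_1,\dots,\psi_4$ such that $\Omega_k=d\psi_k\wedge d\phi^k$ for each $k$ (no summation). 2. For any smooth functions $\psi_k$ with $\Omega_k=d\psi_k\wedge d\phi^k$ ($k=1,\dots,4$) on an open set $V\subseteq U$: each $\psi_k$ is an eigenfunction for $\lambda=\lambda_k$ on $V$; in a neighbourhood of each point of $V$ there is a smooth function $\Theta$ with $d\Theta=\sum_k\psi_k\,d\phi^k$; and every smooth $\Theta$ with $d\Theta=\sum_k\psi_k\,d\phi^k$ on an open subset of $V$ satisfies $\Theta_{y^k}=\psi_k$ there and is a potential of the general heavenly equation, that is, $$A^{lm}=\sum_{i,k}\epsilon^{iklm}\omega_{ik},\qquad \omega_{ik}=(\lambda_k-\lambda_i)\Theta_{y^iy^k},$$ and $$(\lambda_1-\lambda_2)(\lambda_3-\lambda_4)\Theta_{y^1y^2}\Theta_{y^3y^4}+(\lambda_2-\lambda_3)(\lambda_1-\lambda_4)\Theta_{y^2y^3}\Theta_{y^1y^4}+(\lambda_3-\lambda_1)(\lambda_2-\lambda_4)\Theta_{y^3y^1}\Theta_{y^2y^4}=0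 .$$ 3. Conversely, if $\Theta$ is a smooth function on an open set $V\subseteq U$ with $A^{lm}=\sum_{i,k}\epsilon^{iklm}(\lambda_k-\lambda_i)\Theta_{y^iy^k}$ on $V$ for all $l,m$, then $\psi_k=\Theta_{y^k}$ satisfy $\Omega_k=d\psi_k\wedge d\phi^k$ (no summation) and $d\Theta=\sum_k\psi_k\,d\phi^k$ on $V$. -/

import Mathlib

open scoped ContDiff

noncomputable section

namespace SelfDual

variable {𝕜 : Type*} [RCLike 𝕜]

/-! ### Vector fields, Lax pair, eigenfunctions

Points are `x = (x¹,x²,x³,x⁴) : Fin 4 → 𝕜`; the indices `1,2,3,4` are `0,1,2,3 : Fin 4`. -/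

/-- The derivative `V g` of the function `g` along the vector field `V`. -/
def applyVF (V : (Fin 4 → 𝕜) → (Fin 4 → 𝕜)) (g : (Fin 4 → 𝕜) → 𝕜) (x : Fin 4 → 𝕜) : 𝕜 :=
  fderiv 𝕜 g x (V x)

/-- `X(lam) = A₁ + lam A₂`. -/
def laxX (A : Fin 4 → (Fin 4 → 𝕜) → (Fin 4 → 𝕜)) (lam : 𝕜) (x : Fin 4 → 𝕜) : Fin 4 → 𝕜 :=
  A 0 x + lam • A 1 x

/-- `Y(lam) = A₃ + lam A₄`. -/
def laxY (A : Fin 4 → (Fin 4 → 𝕜) → (Fin 4 → 𝕜)) (lam : 𝕜) (x : Fin 4 → 𝕜) : Fin 4 → 𝕜 :=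
  A 2 x + lam • A 3 x

/-- `f` times the divergence of `V` with respect to the volume form `f dx¹∧dx²∧dx³∧dx⁴`, that is
`∑ i, ∂(f Vⁱ)/∂xⁱ`. -/
def weightedDiv (f : (Fin 4 → 𝕜) → 𝕜) (V : (Fin 4 → 𝕜) → (Fin 4 → 𝕜)) (x : Fin 4 → 𝕜) : 𝕜 :=
  ∑ i, fderiv 𝕜 (fun z => f z * V z i) x (Pi.single i 1)

/-- The self-dual Einstein equations on the coordinate domain `U`: the vector fields
`X(lam) = A₁ + lam A₂` and `Y(lam) = A₃ + lam A₄` commute for every `lam`, and the `A α` are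
divergence free with respect to the volume form `f dx¹∧dx²∧dx³∧dx⁴`. -/
structure IsSelfDualEinstein (U : Set (Fin 4 → 𝕜)) (A : Fin 4 → (Fin 4 → 𝕜) → (Fin 4 → 𝕜))
    (f : (Fin 4 → 𝕜) → 𝕜) : Prop where
  smooth_field : ∀ α, ContDiffOn 𝕜 ∞ (A α) U
  smooth_vol : ContDiffOn 𝕜 ∞ f U
  vol_ne_zero : ∀ x ∈ U, f x ≠ 0
  commute : ∀ lam : 𝕜, ∀ x ∈ U, VectorField.lieBracket 𝕜 (laxX A lam) (laxY A lam) x = 0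
  div_free : ∀ α, ∀ x ∈ U, weightedDiv f (A α) x = 0

/-- `Φ` is an eigenfunction on `U` for the parameter `lam`: `X(lam)Φ = 0` and `Y(lam)Φ = 0`. -/
structure IsEigenfunction (A : Fin 4 → (Fin 4 → 𝕜) → (Fin 4 → 𝕜)) (U : Set (Fin 4 → 𝕜))
    (lam : 𝕜) (Φ : (Fin 4 → 𝕜) → 𝕜) : Prop where
  smooth : ContDiffOn 𝕜 ∞ Φ U
  annihilated_X : ∀ x ∈ U, applyVF (laxX A lam) Φ x = 0
  annihilated_Y : ∀ x ∈ U, applyVF (laxY A lam) Φ x = 0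

/-! ### The coordinates `yⁱ = φⁱ` -/

/-- The Jacobian matrix `(∂φⁱ/∂xᵏ)`. -/
def jacobian (φ : Fin 4 → (Fin 4 → 𝕜) → 𝕜) (x : Fin 4 → 𝕜) : Matrix (Fin 4) (Fin 4) 𝕜 :=
  Matrix.of fun i k => fderiv 𝕜 (φ i) x (Pi.single k 1)

/-- The partial derivative `∂g/∂yᵏ` with respect to the coordinates `yⁱ = φⁱ`, at a point where the
Jacobian matrix is invertible: `∂/∂yᵏ = ∑ j, (∂xʲ/∂yᵏ) ∂/∂xʲ`, the matrix `(∂xʲ/∂yᵏ)` being the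
inverse of `(∂yⁱ/∂xᵏ)`. -/
def coordPartial (φ : Fin 4 → (Fin 4 → 𝕜) → 𝕜) (k : Fin 4) (g : (Fin 4 → 𝕜) → 𝕜)
    (x : Fin 4 → 𝕜) : 𝕜 :=
  fderiv 𝕜 g x (fun j => (jacobian φ x)⁻¹ j k)

/-- If `g` is the function `T` of the coordinates `y = φ(x)`, then `coordPartial φ k g` is the
usual partial derivative of `T` with respect to its `k`-th argument. -/
theorem coordPartial_comp (φ : Fin 4 → (Fin 4 → 𝕜) → 𝕜) (k : Fin 4) (T : (Fin 4 → 𝕜) → 𝕜)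
    (x : Fin 4 → 𝕜) (hφ : ∀ i, DifferentiableAt 𝕜 (φ i) x) (hJ : (jacobian φ x).det ≠ 0)
    (hT : DifferentiableAt 𝕜 T (fun i => φ i x)) :
    coordPartial φ k (fun z => T (fun i => φ i z)) x
      = fderiv 𝕜 T (fun i => φ i x) (Pi.single k 1) := by
  have h1 : HasFDerivAt (fun z => T (fun i => φ i z))
      ((fderiv 𝕜 T (fun i => φ i x)).comp (ContinuousLinearMap.pi fun i => fderiv 𝕜 (φ i) x)) x :=
    HasFDerivAt.comp (g := T) x hT.hasFDerivAt
      (hasFDerivAt_pi.2 fun i => (hφ i).hasFDerivAt)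
  have hinv : jacobian φ x * (jacobian φ x)⁻¹ = 1 :=
    Matrix.mul_nonsing_inv _ (isUnit_iff_ne_zero.2 hJ)
  unfold coordPartial
  rw [h1.fderiv, ContinuousLinearMap.comp_apply]
  congr 1
  ext i
  rw [ContinuousLinearMap.pi_apply]
  have h2 := congrFun (congrFun hinv i) k
  rw [Matrix.mul_apply] at h2
  have h3 : ∀ j, fderiv 𝕜 (φ i) x (Pi.single j ((jacobian φ x)⁻¹ j k))
      = jacobian φ x i j * (jacobian φ x)⁻¹ j k := by
    intro j
    have : (Pi.single j ((jacobian φ x)⁻¹ j k) : Fin 4 → 𝕜)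
        = (jacobian φ x)⁻¹ j k • (Pi.single j 1 : Fin 4 → 𝕜) := by
      rw [← Pi.single_smul]; simp
    rw [this, map_smul, smul_eq_mul, mul_comm]
    rfl
  rw [← Finset.univ_sum_single (fun j => (jacobian φ x)⁻¹ j k), map_sum,
    Finset.sum_congr rfl fun j _ => h3 j, h2, Matrix.one_apply, Pi.single_apply]

/-! ### The two-forms `Ω_k` -/

/-- The totally antisymmetric Levi-Civita symbol with `ε 0 1 2 3 = 1`. -/
def leviCivita (i k l m : Fin 4) : ℤ :=
  Int.sign (((k : ℤ) - (i : ℤ)) * ((l : ℤ) - (i : ℤ)) * ((m : ℤ) - (i : ℤ)) *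
    ((l : ℤ) - (k : ℤ)) * ((m : ℤ) - (k : ℤ)) * ((m : ℤ) - (l : ℤ)))

/-- The exterior product `α ∧ β` of two covectors. -/
def wedge (α β : (Fin 4 → 𝕜) →L[𝕜] 𝕜) : (Fin 4 → 𝕜) [⋀^Fin 2]→L[𝕜] 𝕜 :=
  ContinuousMultilinearMap.alternatization
    ((ContinuousMultilinearMap.mkPiAlgebra 𝕜 (Fin 2) 𝕜).compContinuousLinearMap ![α, β])

theorem wedge_apply (α β : (Fin 4 → 𝕜) →L[𝕜] 𝕜) (v : Fin 2 → Fin 4 → 𝕜) :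
    wedge α β v = α (v 0) * β (v 1) - α (v 1) * β (v 0) := by
  have h : (Finset.univ : Finset (Equiv.Perm (Fin 2))) = {1, Equiv.swap 0 1} := by decide
  have hne : (1 : Equiv.Perm (Fin 2)) ≠ Equiv.swap 0 1 := by decide
  rw [wedge, ContinuousMultilinearMap.alternatization_apply_apply, h, Finset.sum_pair hne]
  simp [Fin.prod_univ_two, sub_eq_add_neg]

/-- `Ã^{lm} = (A₄φˡ)(A₂φᵐ) - (A₂φˡ)(A₄φᵐ)`. -/
def tildeA (A : Fin 4 → (Fin 4 → 𝕜) → (Fin 4 → 𝕜)) (φ : Fin 4 → (Fin 4 → 𝕜) → 𝕜)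
    (l m : Fin 4) (x : Fin 4 → 𝕜) : 𝕜 :=
  applyVF (A 3) (φ l) x * applyVF (A 1) (φ m) x - applyVF (A 1) (φ l) x * applyVF (A 3) (φ m) x

/-- `A^{lm} = (f / J) Ã^{lm}` with `J = det (∂φⁱ/∂xᵏ)`. -/
def coeffA (A : Fin 4 → (Fin 4 → 𝕜) → (Fin 4 → 𝕜)) (f : (Fin 4 → 𝕜) → 𝕜)
    (φ : Fin 4 → (Fin 4 → 𝕜) → 𝕜) (l m : Fin 4) (x : Fin 4 → 𝕜) : 𝕜 :=
  f x / (jacobian φ x).det * tildeA A φ l m x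

/-- `Ω_k = ¼ ∑_{i,l,m} ε_{iklm} A^{lm} / (lam_k - lam_i) dφⁱ ∧ dφᵏ` (no sum over `k`; the terms
with `i = k` vanish because `ε` does). -/
def Omega (A : Fin 4 → (Fin 4 → 𝕜) → (Fin 4 → 𝕜)) (f : (Fin 4 → 𝕜) → 𝕜) (lam : Fin 4 → 𝕜)
    (φ : Fin 4 → (Fin 4 → 𝕜) → 𝕜) (k : Fin 4) (x : Fin 4 → 𝕜) :
    (Fin 4 → 𝕜) [⋀^Fin 2]→L[𝕜] 𝕜 :=
  ∑ i, ∑ l, ∑ m, ((1 / 4 : 𝕜) * (leviCivita i k l m : 𝕜) * coeffA A f φ l m x / (lam k - lam i)) •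
    wedge (fderiv 𝕜 (φ i) x) (fderiv 𝕜 (φ k) x)

/-- The `ψ_k` are smooth functions on `V` with `Ω_k = dψ_k ∧ dφᵏ` (no sum over `k`). -/
structure IsFactorisation (A : Fin 4 → (Fin 4 → 𝕜) → (Fin 4 → 𝕜)) (f : (Fin 4 → 𝕜) → 𝕜)
    (lam : Fin 4 → 𝕜) (φ : Fin 4 → (Fin 4 → 𝕜) → 𝕜) (V : Set (Fin 4 → 𝕜))
    (ψ : Fin 4 → (Fin 4 → 𝕜) → 𝕜) : Prop where
  smooth : ∀ k, ContDiffOn 𝕜 ∞ (ψ k) V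
  eq_wedge : ∀ k, ∀ x ∈ V, Omega A f lam φ k x = wedge (fderiv 𝕜 (ψ k) x) (fderiv 𝕜 (φ k) x)

/-- `Θ` is a smooth function on `V` with `dΘ = ∑ k, ψ_k dφᵏ`. -/
structure IsPrimitive (φ ψ : Fin 4 → (Fin 4 → 𝕜) → 𝕜) (V : Set (Fin 4 → 𝕜))
    (Θ : (Fin 4 → 𝕜) → 𝕜) : Prop where
  smooth : ContDiffOn 𝕜 ∞ Θ V
  d_eq : ∀ x ∈ V, fderiv 𝕜 Θ x = ∑ k, ψ k x • fderiv 𝕜 (φ k) x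

/-! ### The potential of the general heavenly equation -/

/-- The second derivative `Θ_{yⁱyᵏ}` with respect to the coordinates `yⁱ = φⁱ`. -/
def coordPartial₂ (φ : Fin 4 → (Fin 4 → 𝕜) → 𝕜) (i k : Fin 4) (Θ : (Fin 4 → 𝕜) → 𝕜) :
    (Fin 4 → 𝕜) → 𝕜 :=
  coordPartial φ k (coordPartial φ i Θ)

/-- `Θ` parametrises the skew-symmetric matrix `A^{lm}` in terms of the coordinates `yⁱ = φⁱ`:
`A^{lm} = ∑_{i,k} ε^{iklm} ω_{ik}` with `ω_{ik} = (lam_k - lam_i) Θ_{yⁱyᵏ}`. -/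
structure IsHeavenlyPotential (A : Fin 4 → (Fin 4 → 𝕜) → (Fin 4 → 𝕜)) (f : (Fin 4 → 𝕜) → 𝕜)
    (lam : Fin 4 → 𝕜) (φ : Fin 4 → (Fin 4 → 𝕜) → 𝕜) (V : Set (Fin 4 → 𝕜))
    (Θ : (Fin 4 → 𝕜) → 𝕜) : Prop where
  smooth : ContDiffOn 𝕜 ∞ Θ V
  coeff_eq : ∀ l m, ∀ x ∈ V, coeffA A f φ l m x
    = ∑ i, ∑ k, (leviCivita i k l m : 𝕜) * ((lam k - lam i) * coordPartial₂ φ i k Θ x)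

/-- The general heavenly equation in the coordinates `yⁱ = φⁱ`, on `V`. -/
def SatisfiesGeneralHeavenly (lam : Fin 4 → 𝕜) (φ : Fin 4 → (Fin 4 → 𝕜) → 𝕜)
    (V : Set (Fin 4 → 𝕜)) (Θ : (Fin 4 → 𝕜) → 𝕜) : Prop :=
  ∀ x ∈ V,
    (lam 0 - lam 1) * (lam 2 - lam 3) * coordPartial₂ φ 0 1 Θ x * coordPartial₂ φ 2 3 Θ x
      + (lam 1 - lam 2) * (lam 0 - lam 3) * coordPartial₂ φ 1 2 Θ x * coordPartial₂ φ 0 3 Θ x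
      + (lam 2 - lam 0) * (lam 1 - lam 3) * coordPartial₂ φ 2 0 Θ x * coordPartial₂ φ 1 3 Θ x = 0

end SelfDual

end

/-! Everything happens in the coordinates `yⁱ = φⁱ`. An eigenfunction satisfies `X(d)φⁱ = (d - λᵢ)
A₂φⁱ` and `Y(d)φⁱ = (d - λᵢ) A₄φⁱ`, so the bivector of `X(λₖ)` and `Y(λₖ)`, weighted by `f/J`, has
components `(λₖ - λₗ)(λₖ - λₘ) A^{lm}` up to order of factors. Two commuting divergence free fields
span a divergence free bivector (`sum_coordPartial_bivector_eq_zero`). Cancelling the constant `λₖ -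
λₗ` leaves `∑ₘ (λₖ - λₘ) ∂ₘA^{lm} = 0` for `l ≠ k`, which says that the coefficients of `Ω_k` form a
closed one-form on each slice `yᵏ = const` (`IsSelfDualEinstein.coordPartial_mixedCoeff_comm`).

The equation `Ω_k = dψ_k ∧ dφᵏ` prescribes exactly the derivatives `∂ᵢψ_k`, `i ≠ k`
(`Omega_eq_wedge_iff`). A Poincaré lemma with `yᵏ` as a parameter (`exists_partial_primitive`)
therefore yields `ψ_k`.

The rest is algebra of the dual `ω_{ik}` of `A^{lm}`. Both `ω_{ik}` and `λₖ - λᵢ` are antisymmetric,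
so `∂ᵢψ_k = ω_{ik}/(λₖ - λᵢ)` is symmetric and `∑ ψ_k dφᵏ` is closed, which gives `Θ`. The factors
of a decomposable bivector annihilate its dual, which makes `ψ_k` an eigenfunction. The Plücker
relation for `ω_{ik} = (λₖ - λᵢ) Θ_{yⁱyᵏ}` is the general heavenly equation. Duality is invertible
(`coeffA_eq_iff_dualCoeff_eq`), hence the converse. -/

/-! ### Poincaré lemma with parameters -/

section Poincare

open MeasureTheory intervalIntegral Set Metric

variable {𝕜 : Type*} [RCLike 𝕜] {E : Type*} [NormedAddCommGroup E] [NormedSpace 𝕜 E]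

/-- The linear part of the contraction along the range of `P`. -/
def contractionCLM (P : E →L[𝕜] E) (t : ℝ) : E →L[𝕜] E :=
  (ContinuousLinearMap.id 𝕜 E - P) + (t : 𝕜) • P

/-- The affine map contracting the range directions of `P` towards `c` by the factor `t`. -/
def contraction (P : E →L[𝕜] E) (c : E) (t : ℝ) (x : E) : E :=
  c + contractionCLM P t (x - c)

variable (P : E →L[𝕜] E) (c : E)

theorem continuous_contractionCLM : Continuous (contractionCLM P) := by
  unfold contractionCLM
  exact continuous_const.add (Continuous.smul (f := fun t : ℝ => (t : 𝕜)) RCLike.continuous_ofReal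
    continuous_const)

theorem continuous_contraction : Continuous (fun p : ℝ × E => contraction P c p.1 p.2) := by
  unfold contraction
  exact continuous_const.add
    (((continuous_contractionCLM P).comp continuous_fst).clm_apply (by fun_prop))

theorem hasFDerivAt_contraction (t : ℝ) (x : E) :
    HasFDerivAt (contraction P c t) (contractionCLM P t) x := by
  unfold contraction
  simpa using (((contractionCLM P t).hasFDerivAt (x := x - c)).comp x
    ((hasFDerivAt_id x).sub_const c)).const_add c

variable {P c} {B : Set E}

theorem continuousOn_comp_contraction {F : Type*} [TopologicalSpace F] {g : E → F}
    (hmaps : ∀ t ∈ Icc (0 : ℝ) 1, ∀ x ∈ B, contraction P c t x ∈ B) (hg : ContinuousOn g B) :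
    ContinuousOn (fun p : ℝ × E => g (contraction P c p.1 p.2)) (Icc 0 1 ×ˢ B) :=
  hg.comp (continuous_contraction P c).continuousOn fun p hp => hmaps p.1 hp.1 p.2 hp.2

/-- Differentiation under the integral sign: the derivative of the integrand is continuous on the
compact set `[0,1] × closedBall x r`, hence dominated by a constant. The weight `w` is carried along
for the induction on smoothness. -/
theorem hasFDerivAt_integral_comp_contraction [ProperSpace E] (hB : IsOpen B)
    (hmaps : ∀ t ∈ Icc (0 : ℝ) 1, ∀ x ∈ B, contraction P c t x ∈ B)
    {w : ℝ → 𝕜} (hw : Continuous w) {g : E → 𝕜} (hg : ContDiffOn 𝕜 1 g B) {x : E} (hx : x ∈ B) :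
    HasFDerivAt (fun y => ∫ t in (0 : ℝ)..1, w t * g (contraction P c t y))
      (∫ t in (0 : ℝ)..1, w t • (fderiv 𝕜 g (contraction P c t x)).comp (contractionCLM P t)) x := by
  obtain ⟨r, hr, hrB⟩ := nhds_basis_closedBall.mem_iff.1 (hB.mem_nhds hx)
  have hdg : ContinuousOn (fderiv 𝕜 g) B := hg.continuousOn_fderiv_of_isOpen hB le_rfl
  have hF : ContinuousOn (fun p : ℝ × E => w p.1 * g (contraction P c p.1 p.2)) (Icc 0 1 ×ˢ B) :=
    (hw.comp continuous_fst).continuousOn.mul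
      (continuousOn_comp_contraction hmaps hg.continuousOn)
  have hF' : ContinuousOn (fun p : ℝ × E => w p.1 •
      (fderiv 𝕜 g (contraction P c p.1 p.2)).comp (contractionCLM P p.1)) (Icc 0 1 ×ˢ B) :=
    (hw.comp continuous_fst).continuousOn.smul
      ((continuousOn_comp_contraction hmaps hdg).clm_comp
        ((continuous_contractionCLM P).comp continuous_fst).continuousOn)
  have slice : ∀ y ∈ B, ContinuousOn (fun t : ℝ => (t, y)) (Icc 0 1) ∧
      MapsTo (fun t : ℝ => (t, y)) (Icc 0 1) (Icc 0 1 ×ˢ B) :=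
    fun y hy => ⟨by fun_prop, fun t ht => ⟨ht, hy⟩⟩
  obtain ⟨C, hC⟩ := (isCompact_Icc.prod (isCompact_closedBall x r)).exists_bound_of_continuousOn
    (hF'.mono (prod_mono_right hrB))
  have huIoc : uIoc (0 : ℝ) 1 ⊆ Icc 0 1 := by
    rw [uIoc_of_le zero_le_one]; exact Ioc_subset_Icc_self
  refine (hasFDerivAt_integral_of_dominated_of_fderiv_le (bound := fun _ => C)
    (F := fun y t => w t * g (contraction P c t y))
    (F' := fun y t => w t • (fderiv 𝕜 g (contraction P c t y)).comp (contractionCLM P t))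
    (closedBall_mem_nhds x hr) ?_ ?_ ?_ ?_ ?_ ?_)
  · filter_upwards [hB.mem_nhds hx] with y hy
    exact ((hF.comp (slice y hy).1 (slice y hy).2).mono huIoc).aestronglyMeasurable measurableSet_uIoc
  · apply ContinuousOn.intervalIntegrable
    rw [uIcc_of_le zero_le_one]
    exact hF.comp (slice x hx).1 (slice x hx).2
  · exact ((hF'.comp (slice x hx).1 (slice x hx).2).mono huIoc).aestronglyMeasurable measurableSet_uIoc
  · exact Filter.Eventually.of_forall fun t ht y hy => hC (t, y) ⟨huIoc ht, hy⟩
  · exact intervalIntegrable_const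
  · refine Filter.Eventually.of_forall fun t ht y hy => ?_
    have hgd : DifferentiableAt 𝕜 g (contraction P c t y) :=
      (hg.contDiffAt (hB.mem_nhds (hmaps t (huIoc ht) y (hrB hy)))).differentiableAt one_ne_zero
    exact (hgd.hasFDerivAt.comp y (hasFDerivAt_contraction P c t y)).const_mul (w t)

/-- Induction on `n` with `w` and `g` arbitrary. A direction `v` splits into `v - P v`, which the
contraction leaves alone, and `P v`, which it scales by `t`. The derivative is thus a sum of two
integrals of the same shape, with weights `w t` and `w t * t`. -/
theorem contDiffOn_integral_comp_contraction [FiniteDimensional 𝕜 E] (hB : IsOpen B)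
    (hmaps : ∀ t ∈ Icc (0 : ℝ) 1, ∀ x ∈ B, contraction P c t x ∈ B) (n : ℕ) :
    ∀ {w : ℝ → 𝕜}, Continuous w → ∀ {g : E → 𝕜}, ContDiffOn 𝕜 ∞ g B →
      ContDiffOn 𝕜 n (fun y => ∫ t in (0 : ℝ)..1, w t * g (contraction P c t y)) B := by
  have : ProperSpace E := FiniteDimensional.proper_rclike 𝕜 E
  have deriv_at : ∀ {w : ℝ → 𝕜}, Continuous w → ∀ {g : E → 𝕜}, ContDiffOn 𝕜 ∞ g B → ∀ x ∈ B,
      HasFDerivAt (fun y => ∫ t in (0 : ℝ)..1, w t * g (contraction P c t y))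
      (∫ t in (0 : ℝ)..1, w t • (fderiv 𝕜 g (contraction P c t x)).comp (contractionCLM P t)) x :=
    fun hw g hg x hx => hasFDerivAt_integral_comp_contraction hB hmaps hw
      (hg.of_le (by exact_mod_cast le_top)) hx
  induction n with
  | zero =>
    intro w hw g hg
    exact contDiffOn_zero.2 fun x hx => (deriv_at hw hg x hx).continuousAt.continuousWithinAt
  | succ n ih =>
    intro w hw g hg
    have hdg : ContDiffOn 𝕜 ∞ (fderiv 𝕜 g) B := hg.fderiv_of_isOpen hB (by simp)
    push_cast
    rw [contDiffOn_succ_iff_fderiv_of_isOpen hB]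
    refine ⟨fun x hx => (deriv_at hw hg x hx).differentiableAt.differentiableWithinAt,
      fun h => absurd h (by simp), contDiffOn_clm_apply.2 fun v => ?_⟩
    have h1 := ih hw (hdg.clm_apply (contDiffOn_const (c := v - P v)))
    have hw2 : Continuous fun t : ℝ => w t * (t : 𝕜) := hw.mul RCLike.continuous_ofReal
    have h2 := ih hw2 (hdg.clm_apply (contDiffOn_const (c := P v)))
    refine (h1.add h2).congr fun x hx => ?_
    have cont : ∀ {w : ℝ → 𝕜}, Continuous w → ∀ u : E, IntervalIntegrable
        (fun t => w t * fderiv 𝕜 g (contraction P c t x) u) volume 0 1 := by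
      intro w hw u
      apply ContinuousOn.intervalIntegrable
      rw [uIcc_of_le zero_le_one]
      exact hw.continuousOn.mul ((continuousOn_comp_contraction hmaps
        (hdg.clm_apply (contDiffOn_const (c := u))).continuousOn).comp
          (f := fun t => (t, x)) (by fun_prop) fun t ht => ⟨ht, hx⟩)
    rw [(deriv_at hw hg x hx).fderiv, ContinuousLinearMap.intervalIntegral_apply]
    · rw [← intervalIntegral.integral_add (cont hw _) (cont hw2 _)]
      refine intervalIntegral.integral_congr fun t _ => ?_
      simp [contractionCLM]
      ring
    · apply ContinuousOn.intervalIntegrable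
      rw [uIcc_of_le zero_le_one]
      exact hw.continuousOn.smul (((continuousOn_comp_contraction hmaps hdg.continuousOn).comp
        (f := fun t => (t, x)) (by fun_prop) fun t ht => ⟨ht, hx⟩).clm_comp
          (continuous_contractionCLM P).continuousOn)

/-- Poincaré lemma for one-forms relative to a projection `P`: a one-form that is closed in the
directions of the range of `P` is exact in these directions. -/
theorem exists_primitive_along_projection [FiniteDimensional 𝕜 E] (hB : IsOpen B)
    (hP : ∀ v, P (P v) = P v)
    (hmaps : ∀ t ∈ Icc (0 : ℝ) 1, ∀ x ∈ B, contraction P c t x ∈ B)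
    {η : E → E →L[𝕜] 𝕜} (hη : ContDiffOn 𝕜 ∞ η B)
    (hclosed : ∀ x ∈ B, ∀ u v, fderiv 𝕜 η x (P u) (P v) = fderiv 𝕜 η x (P v) (P u)) :
    ∃ Ψ : E → 𝕜, ContDiffOn 𝕜 ∞ Ψ B ∧ ∀ x ∈ B, ∀ v, fderiv 𝕜 Ψ x (P v) = η x (P v) := by
  have : ProperSpace E := FiniteDimensional.proper_rclike 𝕜 E
  have hηd : ∀ y ∈ B, DifferentiableAt 𝕜 η y := fun y hy =>
    (hη.contDiffAt (hB.mem_nhds hy)).differentiableAt (by simp)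
  have hdη : ContDiffOn 𝕜 ∞ (fderiv 𝕜 η) B := hη.fderiv_of_isOpen hB (by simp)
  let G : E → E →L[𝕜] 𝕜 := fun x => ∫ t in (0 : ℝ)..1, η (contraction P c t x)
  have path : ∀ x ∈ B, ContinuousOn (fun t : ℝ => contraction P c t x) (Icc 0 1) ∧
      MapsTo (fun t : ℝ => contraction P c t x) (Icc 0 1) B := fun x hx =>
    ⟨((continuous_contraction P c).comp (by fun_prop : Continuous fun t : ℝ => (t, x))).continuousOn,
      fun t ht => hmaps t ht x hx⟩
  have hGapply : ∀ x ∈ B, ∀ v, G x v = ∫ t in (0 : ℝ)..1, (1 : 𝕜) * η (contraction P c t x) v := by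
    intro x hx v
    rw [ContinuousLinearMap.intervalIntegral_apply]
    · simp
    · apply ContinuousOn.intervalIntegrable
      rw [uIcc_of_le zero_le_one]
      exact hη.continuousOn.comp (path x hx).1 (path x hx).2
  have hηv : ∀ v, ContDiffOn 𝕜 ∞ (fun x => η x v) B := fun v => hη.clm_apply contDiffOn_const
  have hG : ContDiffOn 𝕜 ∞ G B := contDiffOn_clm_apply.2 fun v =>
    (contDiffOn_infty.2 fun n => contDiffOn_integral_comp_contraction hB hmaps n
      (w := fun _ => 1) continuous_const (hηv v)).congr fun x hx => hGapply x hx v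
  -- The primitive is the integral of `η` along the segment from `x - P (x - c)` to `x`.
  refine ⟨fun x => G x (P (x - c)), hG.clm_apply (by fun_prop), fun x hx v => ?_⟩
  have hGd : DifferentiableAt 𝕜 G x := (hG.contDiffAt (hB.mem_nhds hx)).differentiableAt (by simp)
  have hdηv : ContinuousOn (fun y => fderiv 𝕜 η y (P v) (P (x - c))) B :=
    ((hdη.clm_apply contDiffOn_const).clm_apply contDiffOn_const).continuousOn
  have hlin : HasFDerivAt (fun x => P (x - c)) P x := by
    exact (P.hasFDerivAt (x := x - c)).comp x ((hasFDerivAt_id x).sub_const c)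
  have hDG : ∀ u, fderiv 𝕜 G x (P v) u
      = ∫ t in (0 : ℝ)..1, (t : 𝕜) * fderiv 𝕜 η (contraction P c t x) (P v) u := by
    intro u
    have h1 : HasFDerivAt (fun y => G y u) _ x :=
      (hasFDerivAt_integral_comp_contraction (w := fun _ => 1) hB hmaps continuous_const
        ((hηv u).of_le (by exact_mod_cast le_top)) hx).congr_of_eventuallyEq
        (Filter.eventuallyEq_of_mem (hB.mem_nhds hx) fun y hy => hGapply y hy u)
    have h2 : HasFDerivAt (fun y => G y u) _ x := hGd.hasFDerivAt.clm_apply (hasFDerivAt_const u x)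
    have h3 := congrArg (fun L => L (P v)) (h2.unique h1)
    simp only [add_apply, ContinuousLinearMap.comp_apply,
      zero_apply, map_zero, ContinuousLinearMap.flip_apply, zero_add] at h3
    rw [h3, ContinuousLinearMap.intervalIntegral_apply]
    · refine intervalIntegral.integral_congr fun t ht => ?_
      rw [uIcc_of_le zero_le_one] at ht
      have h4 := ((hηd _ (hmaps t ht x hx)).hasFDerivAt.clm_apply (hasFDerivAt_const u _)).fderiv
      simp [h4, contractionCLM, hP]
    · apply ContinuousOn.intervalIntegrable
      rw [uIcc_of_le zero_le_one]
      exact ContinuousOn.smul (f := fun _ => (1 : 𝕜)) continuousOn_const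
        ((((hηv u).continuousOn_fderiv_of_isOpen hB (by simp)).comp (path x hx).1
          (path x hx).2).clm_comp (continuous_contractionCLM P).continuousOn)
  rw [(hGd.hasFDerivAt.clm_apply hlin).fderiv]
  simp only [add_apply, ContinuousLinearMap.comp_apply,
    ContinuousLinearMap.flip_apply]
  rw [hDG, hGapply x hx, hP, ← intervalIntegral.integral_add]
  rotate_left
  · apply ContinuousOn.intervalIntegrable
    rw [uIcc_of_le zero_le_one]
    exact continuousOn_const.mul ((hηv (P v)).continuousOn.comp (path x hx).1 (path x hx).2)
  · apply ContinuousOn.intervalIntegrable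
    rw [uIcc_of_le zero_le_one]
    exact RCLike.continuous_ofReal.continuousOn.mul
      (hdηv.comp (path x hx).1 (path x hx).2)
  -- Closedness allows `P v` and `P (x - c)` to be exchanged, after which the integrand is the
  -- `t`-derivative of `t * η (contraction P c t x) (P v)`. The endpoint `t = 1` gives `η x (P v)`
  -- and `t = 0` gives zero.
  have hderiv : ∀ t ∈ uIcc (0 : ℝ) 1,
      HasDerivAt (fun t : ℝ => (t : 𝕜) * η (contraction P c t x) (P v))
        (1 * η (contraction P c t x) (P v)
          + (t : 𝕜) * fderiv 𝕜 η (contraction P c t x) (P v) (P (x - c))) t := by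
    intro t ht
    rw [uIcc_of_le zero_le_one] at ht
    have hy := hmaps t ht x hx
    have hline : HasDerivAt (fun s : 𝕜 => c + ((x - c) - P (x - c) + s • P (x - c)))
        (P (x - c)) (t : 𝕜) := by
      simpa using ((((hasDerivAt_id (t : 𝕜)).smul_const (P (x - c))).const_add
        ((x - c) - P (x - c))).const_add c)
    have hcast : HasDerivAt (fun t : ℝ => (t : 𝕜)) 1 t := by
      simpa using (RCLike.ofRealCLM (K := 𝕜)).hasDerivAt (x := t)
    have hval : HasFDerivAt (fun y => η y (P v)) _ (contraction P c t x) :=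
      (hηd _ hy).hasFDerivAt.clm_apply (hasFDerivAt_const (P v) _)
    have hmul := (hasDerivAt_id (t : 𝕜)).mul (hval.comp_hasDerivAt_of_eq (t : 𝕜) hline
      (by simp [contraction, contractionCLM]))
    have hcomp := hmul.scomp t hcast
    refine (hcomp.congr_deriv ?_).congr_of_eventuallyEq (Filter.Eventually.of_forall fun s => ?_)
    · have hpt : c + (x - c - P (x - c) + (t : 𝕜) • P (x - c)) = contraction P c t x := by
        simp [contraction, contractionCLM]
      simp only [Function.comp_apply, hpt, hclosed _ hy v (x - c)]
      simp
    · simp [contraction, contractionCLM]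
  rw [intervalIntegral.integral_eq_sub_of_hasDerivAt hderiv]
  · simp [contraction, contractionCLM]
  · apply ContinuousOn.intervalIntegrable
    rw [uIcc_of_le zero_le_one]
    exact (continuousOn_const.mul ((hηv (P v)).continuousOn.comp (path x hx).1 (path x hx).2)).add
      (RCLike.continuous_ofReal.continuousOn.mul
      (hdηv.comp (path x hx).1 (path x hx).2))

end Poincare

/-! ### Derivative of a determinant -/

section Determinant

variable {𝕜 : Type*} [RCLike 𝕜] {G : Type*} [NormedAddCommGroup G] [NormedSpace 𝕜 G]
  {ι : Type*} [Fintype ι] [DecidableEq ι]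

/-- Jacobi's formula for the derivative of a determinant. -/
theorem fderiv_det {M : G → Matrix ι ι 𝕜} {x : G} (hM : ∀ i j, DifferentiableAt 𝕜 (M · i j) x)
    (hx : (M x).det ≠ 0) (v : G) :
    fderiv 𝕜 (fun z => (M z).det) x v
      = (M x).det * ∑ i, ∑ j, (M x)⁻¹ j i * fderiv 𝕜 (M · i j) x v := by
  let D : ContinuousMultilinearMap 𝕜 (fun _ : ι => ι → 𝕜) 𝕜 :=
    ⟨(Matrix.detRowAlternating (n := ι) (R := 𝕜)).toMultilinearMap,
      Continuous.matrix_det (A := fun M : Matrix ι ι 𝕜 => M) continuous_id⟩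
  have hrow : ∀ i, HasFDerivAt (fun z => M z i)
      (ContinuousLinearMap.pi fun j => fderiv 𝕜 (M · i j) x) x :=
    fun i => hasFDerivAt_pi.2 fun j => (hM i j).hasFDerivAt
  have h : HasFDerivAt (fun z => (M z).det) _ x := HasFDerivAt.multilinear_comp (f := D) hrow
  rw [h.fderiv, sum_apply, Finset.mul_sum]
  refine Finset.sum_congr rfl fun i _ => ?_
  have hdet : (M x)⁻¹ = ((M x).det)⁻¹ • (M x).adjugate := by
    rw [Matrix.inv_def, Ring.inverse_eq_inv']
  -- Multilinearity in the rows replaces row `i` by its derivative; Cramer's rule expands this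
  -- determinant in entries of the adjugate.
  change ((M x).updateRow i fun j => fderiv 𝕜 (M · i j) x v).det = _
  rw [← Matrix.cramer_transpose_apply, Matrix.cramer_eq_adjugate_mulVec,
    ← Matrix.adjugate_transpose, Matrix.mulVec, dotProduct, Finset.mul_sum]
  refine Finset.sum_congr rfl fun j _ => ?_
  rw [hdet, Matrix.smul_apply, Matrix.transpose_apply, smul_eq_mul]
  field_simp

end Determinant

namespace SelfDual

variable {𝕜 : Type*} [RCLike 𝕜]

/-! ### The coordinate frame -/

/-- The coordinate vector field `∂/∂yᵏ` of the coordinates `yⁱ = φⁱ`. -/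
noncomputable def frame (φ : Fin 4 → (Fin 4 → 𝕜) → 𝕜) (x : Fin 4 → 𝕜) (k : Fin 4) : Fin 4 → 𝕜 :=
  fun j => (jacobian φ x)⁻¹ j k

theorem coordPartial_eq (φ : Fin 4 → (Fin 4 → 𝕜) → 𝕜) (k : Fin 4) (g : (Fin 4 → 𝕜) → 𝕜)
    (x : Fin 4 → 𝕜) : coordPartial φ k g x = fderiv 𝕜 g x (frame φ x k) := rfl

theorem clm_apply_eq_sum (L : (Fin 4 → 𝕜) →L[𝕜] 𝕜) (v : Fin 4 → 𝕜) :
    L v = ∑ j, v j * L (Pi.single j 1) := by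
  conv_lhs => rw [pi_eq_sum_univ' v, map_sum]
  simp

theorem fderiv_apply_eq_mulVec (φ : Fin 4 → (Fin 4 → 𝕜) → 𝕜) (x v : Fin 4 → 𝕜) :
    (fun i => fderiv 𝕜 (φ i) x v) = (jacobian φ x).mulVec v := by
  ext i
  rw [clm_apply_eq_sum, Matrix.mulVec, dotProduct]
  exact Finset.sum_congr rfl fun j _ => mul_comm _ _

variable {φ : Fin 4 → (Fin 4 → 𝕜) → 𝕜} {x : Fin 4 → 𝕜}

theorem fderiv_frame (hJ : (jacobian φ x).det ≠ 0) (i k : Fin 4) :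
    fderiv 𝕜 (φ i) x (frame φ x k) = if i = k then 1 else 0 := by
  have h := congrFun (congrFun (Matrix.mul_nonsing_inv _ (isUnit_iff_ne_zero.2 hJ)) i) k
  rw [Matrix.one_apply, Matrix.mul_apply] at h
  rw [← h]
  exact congrFun (fderiv_apply_eq_mulVec φ x (frame φ x k)) i

theorem eq_sum_frame (hJ : (jacobian φ x).det ≠ 0) (v : Fin 4 → 𝕜) :
    v = ∑ k, fderiv 𝕜 (φ k) x v • frame φ x k := by
  have h : (jacobian φ x)⁻¹.mulVec ((jacobian φ x).mulVec v) = v := by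
    rw [Matrix.mulVec_mulVec, Matrix.nonsing_inv_mul _ (isUnit_iff_ne_zero.2 hJ),
      Matrix.one_mulVec]
  rw [← fderiv_apply_eq_mulVec] at h
  conv_lhs => rw [← h]
  ext j
  simp [Matrix.mulVec, dotProduct, frame, mul_comm]

theorem clm_apply_eq_sum_frame (hJ : (jacobian φ x).det ≠ 0) (L : (Fin 4 → 𝕜) →L[𝕜] 𝕜)
    (v : Fin 4 → 𝕜) : L v = ∑ k, L (frame φ x k) * fderiv 𝕜 (φ k) x v := by
  conv_lhs => rw [eq_sum_frame hJ v, map_sum]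
  simp [mul_comm]

theorem fderiv_eq_sum_coordPartial (hJ : (jacobian φ x).det ≠ 0) (g : (Fin 4 → 𝕜) → 𝕜) :
    fderiv 𝕜 g x = ∑ k, coordPartial φ k g x • fderiv 𝕜 (φ k) x := by
  ext v
  simp [clm_apply_eq_sum_frame hJ (fderiv 𝕜 g x) v, coordPartial_eq]

theorem applyVF_eq_sum (hJ : (jacobian φ x).det ≠ 0) (V : (Fin 4 → 𝕜) → (Fin 4 → 𝕜))
    (g : (Fin 4 → 𝕜) → 𝕜) :
    applyVF V g x = ∑ k, coordPartial φ k g x * applyVF V (φ k) x :=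
  clm_apply_eq_sum_frame hJ _ _

/-! ### Rules for `coordPartial` -/

theorem coordPartial_congr {g h : (Fin 4 → 𝕜) → 𝕜} {U : Set (Fin 4 → 𝕜)} (hU : IsOpen U)
    (hx : x ∈ U) (hgh : ∀ z ∈ U, g z = h z) (k : Fin 4) :
    coordPartial φ k g x = coordPartial φ k h x := by
  rw [coordPartial_eq, coordPartial_eq,
    (Filter.eventuallyEq_of_mem (hU.mem_nhds hx) hgh).fderiv_eq]

theorem coordPartial_mul {g h : (Fin 4 → 𝕜) → 𝕜} (hg : DifferentiableAt 𝕜 g x)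
    (hh : DifferentiableAt 𝕜 h x) (k : Fin 4) :
    coordPartial φ k (fun z => g z * h z) x
      = g x * coordPartial φ k h x + coordPartial φ k g x * h x := by
  rw [coordPartial_eq, fderiv_fun_mul hg hh]
  simp [coordPartial_eq, mul_comm]

theorem coordPartial_const_mul {g : (Fin 4 → 𝕜) → 𝕜} (hg : DifferentiableAt 𝕜 g x) (c : 𝕜)
    (k : Fin 4) : coordPartial φ k (fun z => c * g z) x = c * coordPartial φ k g x := by
  rw [coordPartial_eq, fderiv_const_mul hg]
  simp [coordPartial_eq]

theorem coordPartial_sub {g h : (Fin 4 → 𝕜) → 𝕜} (hg : DifferentiableAt 𝕜 g x)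
    (hh : DifferentiableAt 𝕜 h x) (k : Fin 4) :
    coordPartial φ k (fun z => g z - h z) x = coordPartial φ k g x - coordPartial φ k h x := by
  rw [coordPartial_eq, fderiv_fun_sub hg hh]
  simp [coordPartial_eq]

/-! ### Smoothness -/

variable {U : Set (Fin 4 → 𝕜)}

theorem _root_.ContDiffOn.differentiableAt_of_isOpen {F : Type*} [NormedAddCommGroup F]
    [NormedSpace 𝕜 F] {g : (Fin 4 → 𝕜) → F} (hg : ContDiffOn 𝕜 ∞ g U) (hU : IsOpen U)
    (hx : x ∈ U) : DifferentiableAt 𝕜 g x :=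
  (hg.contDiffAt (hU.mem_nhds hx)).differentiableAt (by simp)

theorem fderiv_fderiv_comm {g : (Fin 4 → 𝕜) → 𝕜} (hg : ContDiffOn 𝕜 ∞ g U) (hU : IsOpen U)
    (hx : x ∈ U) (u v : Fin 4 → 𝕜) :
    fderiv 𝕜 (fderiv 𝕜 g) x u v = fderiv 𝕜 (fderiv 𝕜 g) x v u :=
  (hg.contDiffAt (hU.mem_nhds hx)).isSymmSndFDerivAt
    (by rw [minSmoothness_of_isRCLikeNormedField]
        exact WithTop.coe_le_coe.2 (le_top : (2 : ℕ∞) ≤ ⊤)) u v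

theorem contDiffOn_applyVF {V : (Fin 4 → 𝕜) → (Fin 4 → 𝕜)} {g : (Fin 4 → 𝕜) → 𝕜} (hU : IsOpen U)
    (hV : ContDiffOn 𝕜 ∞ V U) (hg : ContDiffOn 𝕜 ∞ g U) : ContDiffOn 𝕜 ∞ (applyVF V g) U :=
  (hg.fderiv_of_isOpen hU (by simp)).clm_apply hV

theorem contDiffOn_jacobian (hU : IsOpen U) (hφ : ∀ i, ContDiffOn 𝕜 ∞ (φ i) U) (i j : Fin 4) :
    ContDiffOn 𝕜 ∞ (fun z => jacobian φ z i j) U :=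
  ((hφ i).fderiv_of_isOpen hU (by simp)).clm_apply contDiffOn_const

theorem contDiffOn_det {M : (Fin 4 → 𝕜) → Matrix (Fin 4) (Fin 4) 𝕜}
    (hM : ∀ i j, ContDiffOn 𝕜 ∞ (fun z => M z i j) U) :
    ContDiffOn 𝕜 ∞ (fun z => (M z).det) U := by
  simp only [Matrix.det_apply']
  exact ContDiffOn.sum fun σ _ => contDiffOn_const.mul (contDiffOn_prod fun i _ => hM _ _)

theorem contDiffOn_frame (hU : IsOpen U) (hφ : ∀ i, ContDiffOn 𝕜 ∞ (φ i) U)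
    (hJ : ∀ x ∈ U, (jacobian φ x).det ≠ 0) (k : Fin 4) :
    ContDiffOn 𝕜 ∞ (fun z => frame φ z k) U := by
  have hjac := contDiffOn_jacobian hU hφ
  refine contDiffOn_pi.2 fun j => ?_
  simp only [frame, Matrix.inv_def, Ring.inverse_eq_inv', Matrix.smul_apply, smul_eq_mul,
    Matrix.adjugate_apply]
  refine ((contDiffOn_det hjac).inv hJ).mul (contDiffOn_det fun i l => ?_)
  by_cases h : i = k
  · subst h; simpa using contDiffOn_const
  · simpa [Matrix.updateRow_ne h] using hjac i l

theorem contDiffOn_coordPartial (hU : IsOpen U) (hφ : ∀ i, ContDiffOn 𝕜 ∞ (φ i) U)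
    (hJ : ∀ x ∈ U, (jacobian φ x).det ≠ 0) (k : Fin 4) {g : (Fin 4 → 𝕜) → 𝕜}
    (hg : ContDiffOn 𝕜 ∞ g U) : ContDiffOn 𝕜 ∞ (coordPartial φ k g) U :=
  (hg.fderiv_of_isOpen hU (by simp)).clm_apply (contDiffOn_frame hU hφ hJ k)

/-! ### Divergence in the coordinates `yⁱ = φⁱ` -/

theorem fderiv_applyVF {V : (Fin 4 → 𝕜) → (Fin 4 → 𝕜)} {g : (Fin 4 → 𝕜) → 𝕜} (hU : IsOpen U)
    (hV : ContDiffOn 𝕜 ∞ V U) (hg : ContDiffOn 𝕜 ∞ g U) (hx : x ∈ U) (u : Fin 4 → 𝕜) :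
    fderiv 𝕜 (applyVF V g) x u
      = fderiv 𝕜 (fderiv 𝕜 g) x u (V x) + fderiv 𝕜 g x (fderiv 𝕜 V x u) := by
  have h : HasFDerivAt (applyVF V g) _ x :=
    ((hg.fderiv_of_isOpen hU (m := ∞) (by simp)).differentiableAt_of_isOpen
      hU hx).hasFDerivAt.clm_apply (hV.differentiableAt_of_isOpen hU hx).hasFDerivAt
  rw [h.fderiv]
  simp [add_comm]

/-- The trace is independent of the basis, and the frame and the `dφᵐ` are dual bases. -/
theorem sum_fderiv_frame_eq_trace (hJ : (jacobian φ x).det ≠ 0)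
    (D : (Fin 4 → 𝕜) →L[𝕜] (Fin 4 → 𝕜)) :
    ∑ m, fderiv 𝕜 (φ m) x (D (frame φ x m)) = ∑ i, D (Pi.single i 1) i := by
  have h1 : ∀ i, D (Pi.single i 1) i
      = ∑ m, fderiv 𝕜 (φ m) x (D (Pi.single i 1)) * frame φ x m i := by
    intro i
    conv_lhs => rw [eq_sum_frame hJ (D (Pi.single i 1))]
    simp
  have h2 : ∀ m, fderiv 𝕜 (φ m) x (D (frame φ x m))
      = ∑ i, frame φ x m i * fderiv 𝕜 (φ m) x (D (Pi.single i 1)) :=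
    fun m => clm_apply_eq_sum ((fderiv 𝕜 (φ m) x).comp D) (frame φ x m)
  rw [Finset.sum_congr rfl fun i _ => h1 i, Finset.sum_congr rfl fun m _ => h2 m,
    Finset.sum_comm]
  exact Finset.sum_congr rfl fun i _ => Finset.sum_congr rfl fun m _ => mul_comm _ _

/-- Jacobi's formula: contracting the inverse Jacobian with the derivatives of the Jacobian entries
inserts `∂/∂yᵐ` into the Hessian of `φ m`. -/
theorem fderiv_det_jacobian (hU : IsOpen U) (hφ : ∀ i, ContDiffOn 𝕜 ∞ (φ i) U)
    (hJ : (jacobian φ x).det ≠ 0) (hx : x ∈ U) (v : Fin 4 → 𝕜) :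
    fderiv 𝕜 (fun z => (jacobian φ z).det) x v
      = (jacobian φ x).det * ∑ m, fderiv 𝕜 (fderiv 𝕜 (φ m)) x (frame φ x m) v := by
  rw [fderiv_det (fun i j => (contDiffOn_jacobian hU hφ i j).differentiableAt_of_isOpen hU hx) hJ]
  congr 1
  refine Finset.sum_congr rfl fun m _ => ?_
  rw [fderiv_fderiv_comm (hφ m) hU hx, clm_apply_eq_sum]
  refine Finset.sum_congr rfl fun j _ => ?_
  have h : HasFDerivAt (fun z => jacobian φ z m j) _ x :=
    (((hφ m).fderiv_of_isOpen hU (m := ∞) (by simp)).differentiableAt_of_isOpen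
      hU hx).hasFDerivAt.clm_apply (hasFDerivAt_const (Pi.single j 1 : Fin 4 → 𝕜) x)
  rw [h.fderiv]
  simp [frame]

/-- The divergence with respect to a volume form, expressed in the coordinates `yⁱ = φⁱ`. -/
theorem weightedDiv_eq (hU : IsOpen U) (hφ : ∀ i, ContDiffOn 𝕜 ∞ (φ i) U)
    (hJ : ∀ x ∈ U, (jacobian φ x).det ≠ 0) {f : (Fin 4 → 𝕜) → 𝕜} (hf : ContDiffOn 𝕜 ∞ f U)
    {V : (Fin 4 → 𝕜) → (Fin 4 → 𝕜)} (hV : ContDiffOn 𝕜 ∞ V U) (hx : x ∈ U) :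
    weightedDiv f V x = (jacobian φ x).det *
      ∑ m, coordPartial φ m (fun z => f z / (jacobian φ z).det * applyVF V (φ m) z) x := by
  have hdet := contDiffOn_det (contDiffOn_jacobian hU hφ)
  have hdens : ContDiffOn 𝕜 ∞ (fun z => f z / (jacobian φ z).det) U := hf.div hdet hJ
  have hVd := hV.differentiableAt_of_isOpen hU hx
  have hfd := hf.differentiableAt_of_isOpen hU hx
  have hleft : weightedDiv f V x
      = fderiv 𝕜 f x (V x) + f x * ∑ i, fderiv 𝕜 V x (Pi.single i 1) i := by
    rw [clm_apply_eq_sum (fderiv 𝕜 f x), weightedDiv, Finset.mul_sum, ← Finset.sum_add_distrib]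
    refine Finset.sum_congr rfl fun i _ => ?_
    have hVi : HasFDerivAt (fun z => V z i) _ x := hasFDerivAt_pi'.1 hVd.hasFDerivAt i
    rw [fderiv_fun_mul hfd hVi.differentiableAt, hVi.fderiv]
    simp [add_comm]
  have hright : ∀ m, coordPartial φ m (fun z => f z / (jacobian φ z).det * applyVF V (φ m) z) x
      = f x / (jacobian φ x).det * (fderiv 𝕜 (fderiv 𝕜 (φ m)) x (frame φ x m) (V x)
        + fderiv 𝕜 (φ m) x (fderiv 𝕜 V x (frame φ x m)))
        + coordPartial φ m (fun z => f z / (jacobian φ z).det) x * applyVF V (φ m) x := by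
    intro m
    rw [coordPartial_mul (hdens.differentiableAt_of_isOpen hU hx)
      ((contDiffOn_applyVF hU hV (hφ m)).differentiableAt_of_isOpen hU hx),
      coordPartial_eq φ m (applyVF V (φ m)), fderiv_applyVF hU hV (hφ m) hx]
  have hdetV := fderiv_det_jacobian hU hφ (hJ x hx) hx (V x)
  -- Differentiating `f = (f / J) * J` along `V` makes the derivative of `J` produce the Hessian
  -- terms that occur in `hright`.
  have hdensV : fderiv 𝕜 f x (V x)
      = f x / (jacobian φ x).det * fderiv 𝕜 (fun z => (jacobian φ z).det) x (V x)
        + (jacobian φ x).det * fderiv 𝕜 (fun z => f z / (jacobian φ z).det) x (V x) := by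
    have hmul := fderiv_fun_mul (hdens.differentiableAt_of_isOpen hU hx)
      (hdet.differentiableAt_of_isOpen hU hx)
    have heq : fderiv 𝕜 f x
        = fderiv 𝕜 (fun z => f z / (jacobian φ z).det * (jacobian φ z).det) x :=
      Filter.EventuallyEq.fderiv_eq (Filter.eventuallyEq_of_mem (hU.mem_nhds hx)
        fun z hz => (div_mul_cancel₀ _ (hJ z hz)).symm)
    rw [heq, hmul]
    simp
  have hchain := applyVF_eq_sum (hJ x hx) V (fun z => f z / (jacobian φ z).det)
  rw [applyVF] at hchain
  rw [hleft, hdensV, hdetV, hchain, Finset.sum_congr rfl fun m _ => hright m,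
    Finset.sum_add_distrib, ← Finset.mul_sum, Finset.sum_add_distrib,
    sum_fderiv_frame_eq_trace (hJ x hx)]
  have := hJ x hx
  field_simp
  ring

/-- The Hessian of `g` is symmetric and cancels; what remains is `dg` applied to the bracket. -/
theorem applyVF_comm_of_lieBracket_eq_zero {V W : (Fin 4 → 𝕜) → (Fin 4 → 𝕜)}
    {g : (Fin 4 → 𝕜) → 𝕜} (hU : IsOpen U) (hV : ContDiffOn 𝕜 ∞ V U) (hW : ContDiffOn 𝕜 ∞ W U)
    (hg : ContDiffOn 𝕜 ∞ g U) (hx : x ∈ U) (hVW : VectorField.lieBracket 𝕜 V W x = 0) :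
    applyVF V (applyVF W g) x = applyVF W (applyVF V g) x := by
  have h := congrArg (fderiv 𝕜 g x) hVW
  rw [VectorField.lieBracket, map_sub, map_zero] at h
  rw [applyVF, fderiv_applyVF hU hW hg hx, applyVF, fderiv_applyVF hU hV hg hx,
    fderiv_fderiv_comm hg hU hx (V x) (W x)]
  linear_combination h

/-- The bivector field of two commuting divergence free vector fields is divergence free. -/
theorem sum_coordPartial_bivector_eq_zero (hU : IsOpen U) (hφ : ∀ i, ContDiffOn 𝕜 ∞ (φ i) U)
    (hJ : ∀ x ∈ U, (jacobian φ x).det ≠ 0) {f : (Fin 4 → 𝕜) → 𝕜} (hf : ContDiffOn 𝕜 ∞ f U)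
    {V W : (Fin 4 → 𝕜) → (Fin 4 → 𝕜)} (hV : ContDiffOn 𝕜 ∞ V U) (hW : ContDiffOn 𝕜 ∞ W U)
    (hx : x ∈ U) (hdivV : weightedDiv f V x = 0) (hdivW : weightedDiv f W x = 0)
    (hVW : VectorField.lieBracket 𝕜 V W x = 0) (l : Fin 4) :
    ∑ m, coordPartial φ m (fun z => f z / (jacobian φ z).det *
      (applyVF W (φ l) z * applyVF V (φ m) z - applyVF V (φ l) z * applyVF W (φ m) z)) x = 0 := by
  have hdens : ContDiffOn 𝕜 ∞ (fun z => f z / (jacobian φ z).det) U :=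
    hf.div (contDiffOn_det (contDiffOn_jacobian hU hφ)) hJ
  -- By the product rule, the terms differentiating the density times `V φᵐ` add up to a multiple of
  -- the divergence of `V`, and the chain rule sums the others to `(f / J) V(W φˡ)`. The two halves
  -- of the bivector then differ by the bracket.
  have half : ∀ {V W : (Fin 4 → 𝕜) → (Fin 4 → 𝕜)}, ContDiffOn 𝕜 ∞ V U → ContDiffOn 𝕜 ∞ W U →
      weightedDiv f V x = 0 → ∑ m, coordPartial φ m (fun z => applyVF W (φ l) z *
        (f z / (jacobian φ z).det * applyVF V (φ m) z)) x
        = f x / (jacobian φ x).det * applyVF V (applyVF W (φ l)) x := by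
    intro V W hV hW hdiv
    rw [weightedDiv_eq hU hφ hJ hf hV hx, mul_eq_zero, or_iff_right (hJ x hx)] at hdiv
    rw [applyVF_eq_sum (hJ x hx) V (applyVF W (φ l)), Finset.mul_sum]
    have hterm : ∀ m, coordPartial φ m (fun z => applyVF W (φ l) z *
        (f z / (jacobian φ z).det * applyVF V (φ m) z)) x
        = applyVF W (φ l) x *
          coordPartial φ m (fun z => f z / (jacobian φ z).det * applyVF V (φ m) z) x
          + f x / (jacobian φ x).det
            * (coordPartial φ m (applyVF W (φ l)) x * applyVF V (φ m) x) := by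
      intro m
      rw [coordPartial_mul ((contDiffOn_applyVF hU hW (hφ l)).differentiableAt_of_isOpen hU hx)
        ((hdens.mul (contDiffOn_applyVF hU hV (hφ m))).differentiableAt_of_isOpen hU hx)]
      ring
    rw [Finset.sum_congr rfl fun m _ => hterm m, Finset.sum_add_distrib, ← Finset.mul_sum, hdiv,
      mul_zero, zero_add]
  have hsplit : ∀ m, coordPartial φ m (fun z => f z / (jacobian φ z).det *
      (applyVF W (φ l) z * applyVF V (φ m) z - applyVF V (φ l) z * applyVF W (φ m) z)) x
      = coordPartial φ m (fun z => applyVF W (φ l) z *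
        (f z / (jacobian φ z).det * applyVF V (φ m) z)) x
      - coordPartial φ m (fun z => applyVF V (φ l) z *
        (f z / (jacobian φ z).det * applyVF W (φ m) z)) x := by
    intro m
    have smooth : ∀ {V W : (Fin 4 → 𝕜) → (Fin 4 → 𝕜)}, ContDiffOn 𝕜 ∞ V U →
        ContDiffOn 𝕜 ∞ W U → DifferentiableAt 𝕜 (fun z => applyVF W (φ l) z *
          (f z / (jacobian φ z).det * applyVF V (φ m) z)) x := fun hV hW =>
      ((contDiffOn_applyVF hU hW (hφ l)).mul
        (hdens.mul (contDiffOn_applyVF hU hV (hφ m)))).differentiableAt_of_isOpen hU hx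
    rw [← coordPartial_sub (smooth hV hW) (smooth hW hV)]
    congr 1
    ext z
    ring
  rw [Finset.sum_congr rfl fun m _ => hsplit m, Finset.sum_sub_distrib, half hV hW hdivV,
    half hW hV hdivW, applyVF_comm_of_lieBracket_eq_zero hU hV hW (hφ l) hx hVW, sub_self]

end SelfDual

namespace SelfDual

/-! ### The Levi-Civita symbol -/

theorem leviCivita_swap_first (i k l m : Fin 4) : leviCivita k i l m = -leviCivita i k l m := by
  revert i k l m; decide

theorem leviCivita_swap_outer (i k l m : Fin 4) : leviCivita m k l i = -leviCivita i k l m := by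
  revert i k l m; decide

theorem leviCivita_swap_pairs (i k l m : Fin 4) : leviCivita l m i k = leviCivita i k l m := by
  revert i k l m; decide

theorem leviCivita_self (i l m : Fin 4) : leviCivita i i l m = 0 := by
  revert i l m; decide

theorem leviCivita_mul_self {i k l m : Fin 4} (h : [i, k, l, m].Nodup) :
    leviCivita i k l m * leviCivita i k l m = 1 := by
  revert i k l m; decide

theorem exists_complement {i k : Fin 4} (h : i ≠ k) : ∃ l m, [i, k, l, m].Nodup := by
  revert i k; decide

-- Once `i ≠ k` are fixed, only the two orderings of the complementary pair contribute, with
-- opposite signs. This collapses all double sums below.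
set_option maxRecDepth 10000 in
theorem leviCivita_eq_ite {i k l m : Fin 4} (h : [i, k, l, m].Nodup) (l' m' : Fin 4) :
    leviCivita i k l' m' = leviCivita i k l m *
      ((if l' = l then if m' = m then 1 else 0 else 0)
        - (if l' = m then if m' = l then 1 else 0 else 0)) := by
  revert i k l m l' m'; decide

variable {𝕜 : Type*} [RCLike 𝕜]

theorem sum_leviCivita_mul {i k l m : Fin 4} (h : [i, k, l, m].Nodup) (B : Fin 4 → Fin 4 → 𝕜) :
    ∑ l', ∑ m', (leviCivita i k l' m' : 𝕜) * B l' m'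
      = (leviCivita i k l m : 𝕜) * (B l m - B m l) := by
  have hε : ∀ l' m', (leviCivita i k l' m' : 𝕜) * B l' m' = (leviCivita i k l m : 𝕜) *
      ((if l' = l then if m' = m then B l' m' else 0 else 0)
        - (if l' = m then if m' = l then B l' m' else 0 else 0)) := by
    intro l' m'
    rw [leviCivita_eq_ite h l' m', Int.cast_mul, mul_assoc]
    congr 1
    split_ifs <;> simp
  simp only [hε, ← Finset.mul_sum, Finset.sum_sub_distrib, Finset.sum_ite_irrel,
    Finset.sum_const_zero, Finset.sum_ite_eq', Finset.mem_univ, if_true]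

/-! ### The dual of the bivector and the mixed second derivatives -/

variable (A : Fin 4 → (Fin 4 → 𝕜) → (Fin 4 → 𝕜)) (f : (Fin 4 → 𝕜) → 𝕜) (lam : Fin 4 → 𝕜)
  (φ : Fin 4 → (Fin 4 → 𝕜) → 𝕜)

/-- The dual `ω_{ik} = ¼ ∑_{l,m} ε_{iklm} A^{lm}`. -/
noncomputable def dualCoeff (i k : Fin 4) (x : Fin 4 → 𝕜) : 𝕜 :=
  1 / 4 * ∑ l, ∑ m, (leviCivita i k l m : 𝕜) * coeffA A f φ l m x

/-- The coefficient `ω_{ik} / (lam_k - lam_i)` of `Ω_k`. -/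
noncomputable def mixedCoeff (i k : Fin 4) (x : Fin 4 → 𝕜) : 𝕜 :=
  dualCoeff A f φ i k x / (lam k - lam i)

variable {A f lam φ} {x : Fin 4 → 𝕜}

theorem coeffA_swap (l m : Fin 4) (x : Fin 4 → 𝕜) :
    coeffA A f φ m l x = -coeffA A f φ l m x := by
  simp only [coeffA, tildeA]; ring

theorem coeffA_self (l : Fin 4) (x : Fin 4 → 𝕜) : coeffA A f φ l l x = 0 := by
  simp only [coeffA, tildeA]; ring

theorem dualCoeff_eq {i k l m : Fin 4} (h : [i, k, l, m].Nodup) (x : Fin 4 → 𝕜) :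
    dualCoeff A f φ i k x = 1 / 2 * ((leviCivita i k l m : 𝕜) * coeffA A f φ l m x) := by
  rw [dualCoeff, sum_leviCivita_mul h (fun l m => coeffA A f φ l m x), coeffA_swap l m]
  ring

theorem dualCoeff_swap (i k : Fin 4) (x : Fin 4 → 𝕜) :
    dualCoeff A f φ k i x = -dualCoeff A f φ i k x := by
  simp [dualCoeff, leviCivita_swap_first i k]

theorem dualCoeff_self (i : Fin 4) (x : Fin 4 → 𝕜) : dualCoeff A f φ i i x = 0 := by
  simp [dualCoeff, leviCivita_self]

theorem mixedCoeff_swap (i k : Fin 4) (x : Fin 4 → 𝕜) :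
    mixedCoeff A f lam φ k i x = mixedCoeff A f lam φ i k x := by
  rw [mixedCoeff, dualCoeff_swap, ← neg_sub, neg_div_neg_eq, mixedCoeff]

/-- On the diagonal both sides vanish, so sums over `i` need not exclude `i = k`. -/
theorem sub_mul_mixedCoeff (hlam : Function.Injective lam) (i k : Fin 4) (x : Fin 4 → 𝕜) :
    (lam k - lam i) * mixedCoeff A f lam φ i k x = dualCoeff A f φ i k x := by
  by_cases h : i = k
  · subst h; simp [dualCoeff_self]
  · exact mul_div_cancel₀ _ (sub_ne_zero.2 fun h' => h (hlam h').symm)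

/-- Duality of antisymmetric matrices is invertible: one direction multiplies the complementary
entry by `2ε`, the other by `ε/2` thanks to the factor `1/4`, and `ε² = 1`. Diagonal entries vanish
by antisymmetry. -/
theorem coeffA_eq_iff_dualCoeff_eq {W : Fin 4 → Fin 4 → 𝕜} (hW : ∀ i k, W k i = -W i k) :
    (∀ l m, coeffA A f φ l m x = ∑ i, ∑ k, (leviCivita i k l m : 𝕜) * W i k)
      ↔ ∀ i k, W i k = dualCoeff A f φ i k x := by
  have sum_eq : ∀ {i k l m : Fin 4}, [i, k, l, m].Nodup →
      ∑ l', ∑ m', (leviCivita l' m' i k : 𝕜) * W l' m'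
        = 2 * ((leviCivita i k l m : 𝕜) * W l m) := by
    intro i k l m h
    simp only [leviCivita_swap_pairs]
    rw [sum_leviCivita_mul h, hW l m]
    ring
  have sq : ∀ {i k l m : Fin 4}, [i, k, l, m].Nodup →
      (leviCivita i k l m : 𝕜) * (leviCivita i k l m : 𝕜) = 1 := fun h => by
    exact_mod_cast congrArg (Int.cast : ℤ → 𝕜) (leviCivita_mul_self h)
  constructor
  · intro h i k
    by_cases hik : i = k
    · subst hik
      rw [dualCoeff_self]
      linear_combination (1 / 2 : 𝕜) * hW i i
    · obtain ⟨l, m, hn⟩ := exists_complement hik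
      have hn' : [l, m, i, k].Nodup := by revert hn; revert i k l m; decide
      rw [dualCoeff_eq hn, h, sum_eq hn', leviCivita_swap_pairs i k l m]
      linear_combination -W i k * sq hn
  · intro h l m
    by_cases hlm : l = m
    · subst hlm
      have : ∀ i k, leviCivita i k l l = 0 := fun i k => by
        rw [← leviCivita_swap_pairs, leviCivita_self]
      simp [coeffA_self, this]
    · obtain ⟨i, k, hn⟩ := exists_complement hlm
      have hn' : [i, k, l, m].Nodup := by revert hn; revert i k l m; decide
      rw [sum_eq hn, h, dualCoeff_eq hn', leviCivita_swap_pairs i k l m]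
      linear_combination -coeffA A f φ l m x * sq hn'

/-- The Plücker relation for the decomposable bivector `A^{lm}`. -/
theorem plucker_dualCoeff (x : Fin 4 → 𝕜) :
    dualCoeff A f φ 0 1 x * dualCoeff A f φ 2 3 x + dualCoeff A f φ 1 2 x * dualCoeff A f φ 0 3 x
      + dualCoeff A f φ 2 0 x * dualCoeff A f φ 1 3 x = 0 := by
  have e1 : leviCivita 0 1 2 3 = 1 := by decide
  have e2 : leviCivita 2 3 0 1 = 1 := by decide
  have e3 : leviCivita 1 2 0 3 = 1 := by decide
  have e4 : leviCivita 0 3 1 2 = 1 := by decide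
  have e5 : leviCivita 2 0 1 3 = 1 := by decide
  have e6 : leviCivita 1 3 2 0 = 1 := by decide
  rw [dualCoeff_eq (i := 0) (k := 1) (l := 2) (m := 3) (by decide),
    dualCoeff_eq (i := 2) (k := 3) (l := 0) (m := 1) (by decide),
    dualCoeff_eq (i := 1) (k := 2) (l := 0) (m := 3) (by decide),
    dualCoeff_eq (i := 0) (k := 3) (l := 1) (m := 2) (by decide),
    dualCoeff_eq (i := 2) (k := 0) (l := 1) (m := 3) (by decide),
    dualCoeff_eq (i := 1) (k := 3) (l := 2) (m := 0) (by decide), e1, e2, e3, e4, e5, e6]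
  simp only [coeffA, tildeA]
  push_cast
  ring

/-- Both factors of the bivector annihilate its dual. -/
theorem sum_dualCoeff_mul_eq_zero (k : Fin 4) (x : Fin 4 → 𝕜) :
    ∑ i, dualCoeff A f φ i k x * applyVF (A 1) (φ i) x = 0 ∧
      ∑ i, dualCoeff A f φ i k x * applyVF (A 3) (φ i) x = 0 := by
  -- The hypothesis on `v` is `v ∧ A = 0`. Since `ε` is invariant under cyclic permutations of `i,
  -- l, m` with `k` fixed, three times the contraction is a sum of such vanishing cyclic
  -- expressions.
  have key : ∀ v : Fin 4 → 𝕜, (∀ i l m, v i * coeffA A f φ l m x + v l * coeffA A f φ m i x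
      + v m * coeffA A f φ i l x = 0) → ∑ i, dualCoeff A f φ i k x * v i = 0 := by
    intro v hv
    have h3 : (3 : 𝕜) ≠ 0 := by norm_num
    have hcyc : ∀ i l m, leviCivita m k i l = leviCivita i k l m := by
      revert k; decide
    have hT : ∀ T : Fin 4 → Fin 4 → Fin 4 → 𝕜,
        ∑ i, ∑ l, ∑ m, T m i l = ∑ i, ∑ l, ∑ m, T i l m := by
      intro T
      rw [Finset.sum_comm' (t' := Finset.univ) (s' := fun _ => Finset.univ) (by simp)]
      simp only [Fin.sum_univ_four]
      ring
    let S : Fin 4 → Fin 4 → Fin 4 → 𝕜 := fun i l m =>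
      (leviCivita i k l m : 𝕜) * (coeffA A f φ l m x * v i)
    have hsum : ∑ i, ∑ l, ∑ m, (S i l m + S l m i + S m i l) = 0 := by
      refine Finset.sum_eq_zero fun i _ => Finset.sum_eq_zero fun l _ =>
        Finset.sum_eq_zero fun m _ => ?_
      simp only [S]
      rw [hcyc i l m, ← hcyc l m i]
      linear_combination (leviCivita i k l m : 𝕜) * hv i l m
    simp only [Finset.sum_add_distrib] at hsum
    rw [hT S, hT (fun i l m => S m i l), hT S] at hsum
    have hS : ∑ i, ∑ l, ∑ m, S i l m = 0 := by
      have : (3 : 𝕜) * ∑ i, ∑ l, ∑ m, S i l m = 0 := by linear_combination hsum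
      exact (mul_eq_zero.1 this).resolve_left h3
    simp only [dualCoeff, mul_assoc, Finset.sum_mul, ← Finset.mul_sum]
    simp only [S] at hS
    rw [hS, mul_zero]
  exact ⟨key _ fun i l m => by simp only [coeffA, tildeA]; ring,
    key _ fun i l m => by simp only [coeffA, tildeA]; ring⟩

theorem Omega_eq_sum (k : Fin 4) (x : Fin 4 → 𝕜) :
    Omega A f lam φ k x
      = ∑ i, mixedCoeff A f lam φ i k x • wedge (fderiv 𝕜 (φ i) x) (fderiv 𝕜 (φ k) x) := by
  simp only [Omega, ← Finset.sum_smul]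
  refine Finset.sum_congr rfl fun i _ => ?_
  simp only [mixedCoeff, dualCoeff, Finset.mul_sum, Finset.sum_div, mul_assoc]

theorem sum_smul_wedge_apply (c : Fin 4 → 𝕜) (α : Fin 4 → (Fin 4 → 𝕜) →L[𝕜] 𝕜)
    (β : (Fin 4 → 𝕜) →L[𝕜] 𝕜) (v : Fin 2 → Fin 4 → 𝕜) :
    (∑ i, c i • wedge (α i) β) v = ∑ i, c i * (α i (v 0) * β (v 1) - α i (v 1) * β (v 0)) := by
  simp [ContinuousAlternatingMap.sum_apply, wedge_apply]

/-- Evaluation on `∂/∂yⁱ, ∂/∂yᵏ` isolates the coefficient of `dφⁱ ∧ dφᵏ`. The derivative of `g`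
along `yᵏ` is unconstrained because `dφᵏ ∧ dφᵏ = 0`. -/
theorem Omega_eq_wedge_iff (hJ : (jacobian φ x).det ≠ 0) (k : Fin 4) (g : (Fin 4 → 𝕜) → 𝕜) :
    Omega A f lam φ k x = wedge (fderiv 𝕜 g x) (fderiv 𝕜 (φ k) x)
      ↔ ∀ i, i ≠ k → coordPartial φ i g x = mixedCoeff A f lam φ i k x := by
  rw [Omega_eq_sum]
  constructor
  · intro h i hi
    have h1 := congrArg (fun Ω => Ω ![frame φ x i, frame φ x k]) h
    simp only [sum_smul_wedge_apply, wedge_apply, Matrix.cons_val_zero, Matrix.cons_val_one,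
      fderiv_frame hJ, hi.symm, if_true, if_false, mul_zero, sub_zero, mul_one] at h1
    rw [coordPartial_eq, ← h1]
    simp
  · intro h
    ext v
    rw [sum_smul_wedge_apply, wedge_apply, clm_apply_eq_sum_frame hJ (fderiv 𝕜 g x) (v 0),
      clm_apply_eq_sum_frame hJ (fderiv 𝕜 g x) (v 1), Finset.sum_mul, Finset.sum_mul,
      ← Finset.sum_sub_distrib]
    refine Finset.sum_congr rfl fun i _ => ?_
    by_cases hi : i = k
    · subst hi; ring
    · rw [← coordPartial_eq, h i hi]; ring

end SelfDual

namespace SelfDual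

open Set Metric

variable {𝕜 : Type*} [RCLike 𝕜]

/-! ### Contractions of balls -/

theorem contraction_mem_ball {E : Type*} [NormedAddCommGroup E] [NormedSpace 𝕜 E] {P : E →L[𝕜] E}
    {c x : E} {t r : ℝ} (h : ‖contractionCLM P t (x - c)‖ ≤ ‖x - c‖) (hx : x ∈ ball c r) :
    contraction P c t x ∈ ball c r := by
  rw [mem_ball_iff_norm] at hx ⊢
  rw [contraction, add_sub_cancel_left]
  exact h.trans_lt hx

theorem norm_contractionCLM_id_le {E : Type*} [NormedAddCommGroup E] [NormedSpace 𝕜 E] {t : ℝ}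
    (ht : t ∈ Icc (0 : ℝ) 1) (v : E) :
    ‖contractionCLM (ContinuousLinearMap.id 𝕜 E) t v‖ ≤ ‖v‖ := by
  simp only [contractionCLM, sub_self, zero_add, smul_apply, ContinuousLinearMap.id_apply,
    norm_smul, RCLike.norm_ofReal, abs_of_nonneg ht.1]
  exact mul_le_of_le_one_left (norm_nonneg v) ht.2

/-- The projection killing the `k`-th coordinate. -/
noncomputable def dropCoord (𝕜 : Type*) [RCLike 𝕜] (k : Fin 4) :
    (Fin 4 → 𝕜) →L[𝕜] (Fin 4 → 𝕜) :=
  ContinuousLinearMap.pi fun i => if i = k then 0 else ContinuousLinearMap.proj i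

theorem dropCoord_apply (k : Fin 4) (v : Fin 4 → 𝕜) (i : Fin 4) :
    dropCoord 𝕜 k v i = if i = k then 0 else v i := by
  by_cases h : i = k <;> simp [dropCoord, h]

/-- The norm is the sup norm, so shrinking some coordinates cannot increase it; balls are therefore
stable under the contraction that fixes `yᵏ`. -/
theorem norm_contractionCLM_dropCoord_le (k : Fin 4) {t : ℝ} (ht : t ∈ Icc (0 : ℝ) 1)
    (v : Fin 4 → 𝕜) : ‖contractionCLM (dropCoord 𝕜 k) t v‖ ≤ ‖v‖ := by
  refine (pi_norm_le_iff_of_nonneg (norm_nonneg v)).2 fun i => ?_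
  refine le_trans ?_ (norm_le_pi_norm v i)
  by_cases h : i = k
  · simp [contractionCLM, dropCoord_apply, h]
  · simp only [contractionCLM, add_apply, sub_apply, smul_apply, ContinuousLinearMap.id_apply,
      Pi.add_apply, Pi.sub_apply, Pi.smul_apply, dropCoord_apply, h, if_false, sub_self, zero_add,
      norm_smul, RCLike.norm_ofReal, abs_of_nonneg ht.1]
    exact mul_le_of_le_one_left (norm_nonneg _) ht.2

/-! ### The coordinates `yⁱ = φⁱ` as a local chart -/

variable {φ : Fin 4 → (Fin 4 → 𝕜) → 𝕜} {x : Fin 4 → 𝕜} {U : Set (Fin 4 → 𝕜)}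

/-- The derivative of the coordinates `yⁱ = φⁱ`, with inverse given by the coordinate frame. -/
noncomputable def coordDerivEquiv (hJ : (jacobian φ x).det ≠ 0) :
    (Fin 4 → 𝕜) ≃L[𝕜] (Fin 4 → 𝕜) :=
  ContinuousLinearEquiv.equivOfInverse (ContinuousLinearMap.pi fun i => fderiv 𝕜 (φ i) x)
    (∑ k, (ContinuousLinearMap.proj (R := 𝕜) (φ := fun _ : Fin 4 => 𝕜) k).smulRight (frame φ x k))
    (fun v => by simpa using (eq_sum_frame hJ v).symm)
    (fun v => by ext i; simp [fderiv_frame hJ])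

/-- Inverse function theorem. Restricting the source to `U`, where `J ≠ 0` throughout, makes the
inverse smooth on the whole target and not only at the image of `p`. -/
theorem exists_chart (hU : IsOpen U) (hφ : ∀ i, ContDiffOn 𝕜 ∞ (φ i) U)
    (hJ : ∀ x ∈ U, (jacobian φ x).det ≠ 0) {p : Fin 4 → 𝕜} (hp : p ∈ U) :
    ∃ e : OpenPartialHomeomorph (Fin 4 → 𝕜) (Fin 4 → 𝕜), p ∈ e.source ∧ e.source ⊆ U ∧
      (∀ z, e z = fun i => φ i z) ∧ ContDiffOn 𝕜 ∞ e.symm e.target := by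
  have hsmooth : ∀ z ∈ U, ContDiffAt 𝕜 ∞ (fun z i => φ i z) z := fun z hz =>
    contDiffAt_pi.2 fun i => (hφ i).contDiffAt (hU.mem_nhds hz)
  have hderiv : ∀ z (hz : z ∈ U), HasFDerivAt (fun z i => φ i z)
      (coordDerivEquiv (hJ z hz) : (Fin 4 → 𝕜) →L[𝕜] (Fin 4 → 𝕜)) z := fun z hz =>
    hasFDerivAt_pi.2 fun i => ((hφ i).differentiableAt_of_isOpen hU hz).hasFDerivAt
  let e₀ := (hsmooth p hp).toOpenPartialHomeomorph _ (hderiv p hp) (by simp)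
  have he₀ : ∀ z, e₀ z = fun i => φ i z := fun z => rfl
  have hsource : (e₀.restrOpen U hU).source ⊆ U := fun z hz => hz.2
  refine ⟨e₀.restrOpen U hU,
    ⟨(hsmooth p hp).mem_toOpenPartialHomeomorph_source (hderiv p hp) (by simp), hp⟩, hsource, he₀,
    fun y hy => ?_⟩
  have hz := hsource ((e₀.restrOpen U hU).map_target hy)
  exact ((e₀.restrOpen U hU).contDiffAt_symm hy (hderiv _ hz) (hsmooth _ hz)).contDiffWithinAt

theorem contDiffOn_coeffA {A : Fin 4 → (Fin 4 → 𝕜) → (Fin 4 → 𝕜)} {f : (Fin 4 → 𝕜) → 𝕜}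
    (hU : IsOpen U) (hA : ∀ α, ContDiffOn 𝕜 ∞ (A α) U) (hf : ContDiffOn 𝕜 ∞ f U)
    (hφ : ∀ i, ContDiffOn 𝕜 ∞ (φ i) U) (hJ : ∀ x ∈ U, (jacobian φ x).det ≠ 0) (l m : Fin 4) :
    ContDiffOn 𝕜 ∞ (coeffA A f φ l m) U := by
  have h := fun α i => contDiffOn_applyVF hU (hA α) (hφ i)
  exact (hf.div (contDiffOn_det (contDiffOn_jacobian hU hφ)) hJ).mul
    (((h 3 l).mul (h 1 m)).sub ((h 1 l).mul (h 3 m)))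

/-! ### One-forms `∑ k, ψ_k dφᵏ` -/

theorem fderiv_sum_smul_fderiv {ψ : Fin 4 → (Fin 4 → 𝕜) → 𝕜} (hU : IsOpen U)
    (hφ : ∀ i, ContDiffOn 𝕜 ∞ (φ i) U) (hψ : ∀ i, ContDiffOn 𝕜 ∞ (ψ i) U) (hx : x ∈ U)
    (u v : Fin 4 → 𝕜) :
    fderiv 𝕜 (fun z => ∑ k, ψ k z • fderiv 𝕜 (φ k) z) x u v
      = ∑ k, fderiv 𝕜 (ψ k) x u * fderiv 𝕜 (φ k) x v
        + ∑ k, ψ k x * fderiv 𝕜 (fderiv 𝕜 (φ k)) x u v := by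
  have h : HasFDerivAt (fun z => ∑ k, ψ k z • fderiv 𝕜 (φ k) z) _ x :=
    HasFDerivAt.fun_sum fun k _ =>
      ((hψ k).differentiableAt_of_isOpen hU hx).hasFDerivAt.smul
        (((hφ k).fderiv_of_isOpen hU (m := ∞) (by simp)).differentiableAt_of_isOpen
          hU hx).hasFDerivAt
  rw [h.fderiv, ← Finset.sum_add_distrib]
  simp [add_comm]

theorem contDiffOn_sum_smul_fderiv {ψ : Fin 4 → (Fin 4 → 𝕜) → 𝕜} (hU : IsOpen U)
    (hφ : ∀ i, ContDiffOn 𝕜 ∞ (φ i) U) (hψ : ∀ i, ContDiffOn 𝕜 ∞ (ψ i) U) :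
    ContDiffOn 𝕜 ∞ (fun z => ∑ k, ψ k z • fderiv 𝕜 (φ k) z) U :=
  ContDiffOn.sum fun k _ => (hψ k).smul ((hφ k).fderiv_of_isOpen hU (by simp))

theorem coordPartial_eq_of_fderiv_eq {ψ : Fin 4 → 𝕜} {Θ : (Fin 4 → 𝕜) → 𝕜}
    (hJ : (jacobian φ x).det ≠ 0) (h : fderiv 𝕜 Θ x = ∑ k, ψ k • fderiv 𝕜 (φ k) x) (k : Fin 4) :
    coordPartial φ k Θ x = ψ k := by
  rw [coordPartial_eq, h]
  simp [fderiv_frame hJ]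

/-- The frame varies with the point, so the Hessian of `Θ` on frame vectors is not `coordPartial₂`
itself. Expanding `dΘ` in the `dφᵏ` shows that the difference consists of Hessians of the `φᵏ`,
which are symmetric. -/
theorem coordPartial₂_comm (hU : IsOpen U) (hφ : ∀ i, ContDiffOn 𝕜 ∞ (φ i) U)
    (hJ : ∀ x ∈ U, (jacobian φ x).det ≠ 0) {Θ : (Fin 4 → 𝕜) → 𝕜} (hΘ : ContDiffOn 𝕜 ∞ Θ U)
    (hx : x ∈ U) (i k : Fin 4) : coordPartial₂ φ i k Θ x = coordPartial₂ φ k i Θ x := by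
  have heq : fderiv 𝕜 (fderiv 𝕜 Θ) x
      = fderiv 𝕜 (fun z => ∑ k, coordPartial φ k Θ z • fderiv 𝕜 (φ k) z) x :=
    Filter.EventuallyEq.fderiv_eq (Filter.eventuallyEq_of_mem (hU.mem_nhds hx)
      fun z hz => fderiv_eq_sum_coordPartial (hJ z hz) Θ)
  have hsymm := fderiv_fderiv_comm hΘ hU hx (frame φ x k) (frame φ x i)
  rw [heq, fderiv_sum_smul_fderiv hU hφ (contDiffOn_coordPartial hU hφ hJ · hΘ) hx,
    fderiv_sum_smul_fderiv hU hφ (contDiffOn_coordPartial hU hφ hJ · hΘ) hx] at hsymm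
  simp only [fderiv_fderiv_comm (hφ _) hU hx (frame φ x k) (frame φ x i), add_left_inj,
    fderiv_frame (hJ x hx), mul_ite, mul_one, mul_zero, Finset.sum_ite_eq', Finset.mem_univ,
    if_true] at hsymm
  exact hsymm

/-- If the matrix `∂ψ_k/∂yⁱ` is symmetric, then `∑ k, ψ_k dφᵏ` is locally exact. -/
theorem exists_isPrimitive {ψ : Fin 4 → (Fin 4 → 𝕜) → 𝕜} (hU : IsOpen U)
    (hφ : ∀ i, ContDiffOn 𝕜 ∞ (φ i) U) (hψ : ∀ i, ContDiffOn 𝕜 ∞ (ψ i) U)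
    (hJ : ∀ x ∈ U, (jacobian φ x).det ≠ 0)
    (hsymm : ∀ x ∈ U, ∀ i k, coordPartial φ i (ψ k) x = coordPartial φ k (ψ i) x)
    {p : Fin 4 → 𝕜} (hp : p ∈ U) :
    ∃ W : Set (Fin 4 → 𝕜), IsOpen W ∧ p ∈ W ∧ W ⊆ U ∧
      ∃ Θ : (Fin 4 → 𝕜) → 𝕜, IsPrimitive φ ψ W Θ := by
  obtain ⟨r, hr, hrU⟩ := Metric.isOpen_iff.1 hU p hp
  obtain ⟨Θ, hΘ, hdΘ⟩ := exists_primitive_along_projection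
    (P := ContinuousLinearMap.id 𝕜 (Fin 4 → 𝕜)) (c := p) isOpen_ball (fun v => rfl)
    (fun t ht x hx => contraction_mem_ball (norm_contractionCLM_id_le ht _) hx)
    ((contDiffOn_sum_smul_fderiv hU hφ hψ).mono hrU) fun x hx u v => by
      have expand : ∀ u v, ∑ k, fderiv 𝕜 (ψ k) x u * fderiv 𝕜 (φ k) x v
          = ∑ k, ∑ i, coordPartial φ i (ψ k) x * fderiv 𝕜 (φ i) x u * fderiv 𝕜 (φ k) x v :=
        fun u v => Finset.sum_congr rfl fun k _ => by
          rw [clm_apply_eq_sum_frame (hJ x (hrU hx)) (fderiv 𝕜 (ψ k) x) u, Finset.sum_mul]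
          rfl
      simp only [ContinuousLinearMap.id_apply]
      rw [fderiv_sum_smul_fderiv hU hφ hψ (hrU hx), fderiv_sum_smul_fderiv hU hφ hψ (hrU hx),
        expand, expand, Finset.sum_comm]
      congr 1
      · refine Finset.sum_congr rfl fun k _ => Finset.sum_congr rfl fun i _ => ?_
        rw [hsymm x (hrU hx) k i]
        ring
      · exact Finset.sum_congr rfl fun k _ => by
          rw [fderiv_fderiv_comm (hφ k) hU (hrU hx)]
  exact ⟨ball p r, isOpen_ball, mem_ball_self hr, hrU, Θ, hΘ,
    fun x hx => ContinuousLinearMap.ext fun v => hdΘ x hx v⟩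

/-- Local solvability of `∂g/∂yⁱ = Sᵢ` for `i ≠ k`, with `yᵏ` as a parameter. -/
theorem exists_partial_primitive (hU : IsOpen U) (hφ : ∀ i, ContDiffOn 𝕜 ∞ (φ i) U)
    (hJ : ∀ x ∈ U, (jacobian φ x).det ≠ 0) (k : Fin 4) {S : Fin 4 → (Fin 4 → 𝕜) → 𝕜}
    (hS : ∀ i, ContDiffOn 𝕜 ∞ (S i) U)
    (hclosed : ∀ x ∈ U, ∀ i j, i ≠ k → j ≠ k → coordPartial φ j (S i) x = coordPartial φ i (S j) x)
    {p : Fin 4 → 𝕜} (hp : p ∈ U) :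
    ∃ V : Set (Fin 4 → 𝕜), IsOpen V ∧ p ∈ V ∧ V ⊆ U ∧ ∃ g : (Fin 4 → 𝕜) → 𝕜,
      ContDiffOn 𝕜 ∞ g V ∧ ∀ x ∈ V, ∀ i, i ≠ k → coordPartial φ i g x = S i x := by
  obtain ⟨e, hpe, heU, he, hesymm⟩ := exists_chart hU hφ hJ hp
  obtain ⟨r, hr, hrT⟩ := Metric.isOpen_iff.1 e.open_target (e p) (e.map_source hpe)
  have hmaps : MapsTo e.symm (ball (e p) r) U := fun y hy => heU (e.map_target (hrT hy))
  have hT : ∀ i, ContDiffOn 𝕜 ∞ (fun y => S i (e.symm y)) (ball (e p) r) := fun i =>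
    (hS i).comp (hesymm.mono hrT) hmaps
  let V := e.source ∩ e ⁻¹' ball (e p) r
  have hV : IsOpen V := e.isOpen_inter_preimage isOpen_ball
  have hVU : V ⊆ U := fun z hz => heU hz.1
  have hcoord : ∀ {T : (Fin 4 → 𝕜) → 𝕜}, ContDiffOn 𝕜 ∞ T (ball (e p) r) → ∀ z ∈ V, ∀ i,
      coordPartial φ i (fun z => T (fun i => φ i z)) z = fderiv 𝕜 T (e z) (Pi.single i 1) := by
    intro T hT z hz i
    have hTz : DifferentiableAt 𝕜 T (e z) := hT.differentiableAt_of_isOpen isOpen_ball hz.2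
    rw [he z] at hTz ⊢
    exact coordPartial_comp φ i T z
      (fun i => (hφ i).differentiableAt_of_isOpen hU (hVU hz)) (hJ z (hVU hz)) hTz
  have hpartialT : ∀ y ∈ ball (e p) r, ∀ i j,
      fderiv 𝕜 (fun y => S i (e.symm y)) y (Pi.single j 1)
        = coordPartial φ j (S i) (e.symm y) := by
    intro y hy i j
    have hz : e.symm y ∈ V :=
      ⟨e.map_target (hrT hy), by rw [mem_preimage, e.right_inv (hrT hy)]; exact hy⟩
    have h := hcoord (hT i) _ hz j
    rw [e.right_inv (hrT hy)] at h
    rw [← h]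
    refine coordPartial_congr hV hz (fun z hz => ?_) j
    rw [← he z, e.left_inv hz.1]
  have hηd : ∀ y ∈ ball (e p) r, ∀ u v, fderiv 𝕜 (fun y => ∑ i, S i (e.symm y) •
      (ContinuousLinearMap.proj (R := 𝕜) (φ := fun _ : Fin 4 => 𝕜) i)) y u v
      = ∑ i, ∑ j, u j * coordPartial φ j (S i) (e.symm y) * v i := by
    intro y hy u v
    have h : HasFDerivAt (fun y => ∑ i, S i (e.symm y) •
        (ContinuousLinearMap.proj (R := 𝕜) (φ := fun _ : Fin 4 => 𝕜) i)) _ y :=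
      HasFDerivAt.fun_sum fun i _ =>
        ((hT i).differentiableAt_of_isOpen isOpen_ball hy).hasFDerivAt.smul_const
          (ContinuousLinearMap.proj (R := 𝕜) (φ := fun _ : Fin 4 => 𝕜) i)
    rw [h.fderiv]
    simp only [sum_apply, ContinuousLinearMap.smulRight_apply, smul_apply,
      ContinuousLinearMap.proj_apply, smul_eq_mul]
    refine Finset.sum_congr rfl fun i _ => ?_
    rw [clm_apply_eq_sum, Finset.sum_mul]
    simp only [hpartialT y hy]
  -- In the chart this is the one-form `∑ Sᵢ dyⁱ`, used only along the slices `yᵏ = const`. The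
  -- summand `i = k` is harmless, as the projection kills its direction.
  obtain ⟨Ψ, hΨ, hdΨ⟩ := exists_primitive_along_projection (P := dropCoord 𝕜 k) (c := e p)
    (η := fun y => ∑ i, S i (e.symm y) •
      (ContinuousLinearMap.proj (R := 𝕜) (φ := fun _ : Fin 4 => 𝕜) i)) (B := ball (e p) r)
    isOpen_ball (fun v => by ext i; by_cases h : i = k <;> simp [dropCoord_apply, h])
    (fun t ht x hx => contraction_mem_ball (norm_contractionCLM_dropCoord_le k ht _) hx)
    (ContDiffOn.sum fun i _ => (hT i).smul contDiffOn_const) fun y hy u v => by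
      rw [hηd y hy, hηd y hy, Finset.sum_comm]
      refine Finset.sum_congr rfl fun i _ => Finset.sum_congr rfl fun j _ => ?_
      simp only [dropCoord_apply]
      by_cases hi : i = k
      · simp [hi]
      by_cases hj : j = k
      · simp [hj]
      rw [hclosed _ (hmaps hy) j i hj hi]
      simp only [hi, hj, if_false]
      ring
  have hφV : ContDiffOn 𝕜 ∞ (fun z i => φ i z) V := contDiffOn_pi.2 fun i => (hφ i).mono hVU
  refine ⟨V, hV, ⟨hpe, mem_ball_self hr⟩, hVU, fun z => Ψ (fun i => φ i z),
    hΨ.comp hφV fun z hz => by rw [← he z]; exact hz.2, fun z hz i hi => ?_⟩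
  have hsingle : dropCoord 𝕜 k (Pi.single i 1) = Pi.single i 1 := by
    ext j
    by_cases hj : j = k
    · simp [dropCoord_apply, hj, Pi.single_eq_of_ne (Ne.symm hi)]
    · simp [dropCoord_apply, hj]
  have h := hdΨ (e z) hz.2 (Pi.single i 1)
  rw [hsingle] at h
  rw [hcoord hΨ z hz, h]
  simp [Pi.single_apply, e.left_inv hz.1]

end SelfDual

namespace SelfDual

variable {𝕜 : Type*} [RCLike 𝕜] {U : Set (Fin 4 → 𝕜)}
  {A : Fin 4 → (Fin 4 → 𝕜) → (Fin 4 → 𝕜)} {f : (Fin 4 → 𝕜) → 𝕜} {lam : Fin 4 → 𝕜}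
  {φ : Fin 4 → (Fin 4 → 𝕜) → 𝕜} {x : Fin 4 → 𝕜}

/-! ### Consequences of the self-dual Einstein equations -/

theorem applyVF_laxX (A : Fin 4 → (Fin 4 → 𝕜) → (Fin 4 → 𝕜)) (c : 𝕜) (g : (Fin 4 → 𝕜) → 𝕜)
    (x : Fin 4 → 𝕜) : applyVF (laxX A c) g x = applyVF (A 0) g x + c * applyVF (A 1) g x := by
  simp [applyVF, laxX]

theorem applyVF_laxY (A : Fin 4 → (Fin 4 → 𝕜) → (Fin 4 → 𝕜)) (c : 𝕜) (g : (Fin 4 → 𝕜) → 𝕜)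
    (x : Fin 4 → 𝕜) : applyVF (laxY A c) g x = applyVF (A 2) g x + c * applyVF (A 3) g x := by
  simp [applyVF, laxY]

theorem IsEigenfunction.applyVF_laxX {c : 𝕜} {g : (Fin 4 → 𝕜) → 𝕜} (hg : IsEigenfunction A U c g)
    (hx : x ∈ U) (d : 𝕜) : applyVF (laxX A d) g x = (d - c) * applyVF (A 1) g x := by
  have h := hg.annihilated_X x hx
  rw [SelfDual.applyVF_laxX] at h ⊢
  linear_combination h

theorem IsEigenfunction.applyVF_laxY {c : 𝕜} {g : (Fin 4 → 𝕜) → 𝕜} (hg : IsEigenfunction A U c g)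
    (hx : x ∈ U) (d : 𝕜) : applyVF (laxY A d) g x = (d - c) * applyVF (A 3) g x := by
  have h := hg.annihilated_Y x hx
  rw [SelfDual.applyVF_laxY] at h ⊢
  linear_combination h

theorem weightedDiv_add_smul {V W : (Fin 4 → 𝕜) → (Fin 4 → 𝕜)} (hU : IsOpen U)
    (hf : ContDiffOn 𝕜 ∞ f U) (hV : ContDiffOn 𝕜 ∞ V U) (hW : ContDiffOn 𝕜 ∞ W U) (hx : x ∈ U)
    (c : 𝕜) : weightedDiv f (fun z => V z + c • W z) x
      = weightedDiv f V x + c * weightedDiv f W x := by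
  have hd : ∀ {V : (Fin 4 → 𝕜) → (Fin 4 → 𝕜)}, ContDiffOn 𝕜 ∞ V U → ∀ i,
      DifferentiableAt 𝕜 (fun z => f z * V z i) x := fun hV i =>
    (hf.mul (contDiffOn_pi.1 hV i)).differentiableAt_of_isOpen hU hx
  simp only [weightedDiv, Finset.mul_sum, ← Finset.sum_add_distrib]
  refine Finset.sum_congr rfl fun i _ => ?_
  have hfun : (fun z => f z * (V z + c • W z) i)
      = fun z => f z * V z i + c * (f z * W z i) := by
    ext z
    simp only [Pi.add_apply, Pi.smul_apply, smul_eq_mul]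
    ring
  rw [hfun, fderiv_fun_add (hd hV i) ((hd hW i).const_mul c), fderiv_const_mul (hd hW i)]
  simp

/-- The only place where commutation and the divergence condition enter. They are used for the Lax
pair at `lam k`, which acts on `φ l` and `φ m` through `A 1` and `A 3` with constant factors; `lam k
- lam l` is nonzero and cancels. -/
theorem IsSelfDualEinstein.sum_coordPartial_coeffA (hA : IsSelfDualEinstein U A f) (hU : IsOpen U)
    (hlam : Function.Injective lam) (hφ : ∀ i, IsEigenfunction A U (lam i) (φ i))
    (hJ : ∀ x ∈ U, (jacobian φ x).det ≠ 0) (hx : x ∈ U) {k l : Fin 4} (hkl : k ≠ l) :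
    ∑ m, (lam k - lam m) * coordPartial φ m (coeffA A f φ l m) x = 0 := by
  have hφs := fun i => (hφ i).smooth
  have hX : ContDiffOn 𝕜 ∞ (laxX A (lam k)) U :=
    (hA.smooth_field 0).add ((hA.smooth_field 1).const_smul (lam k))
  have hY : ContDiffOn 𝕜 ∞ (laxY A (lam k)) U :=
    (hA.smooth_field 2).add ((hA.smooth_field 3).const_smul (lam k))
  have hdX : weightedDiv f (laxX A (lam k)) x = 0 := by
    refine (weightedDiv_add_smul hU hA.smooth_vol (hA.smooth_field 0) (hA.smooth_field 1) hx
      (lam k)).trans ?_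
    rw [hA.div_free 0 x hx, hA.div_free 1 x hx, mul_zero, add_zero]
  have hdY : weightedDiv f (laxY A (lam k)) x = 0 := by
    refine (weightedDiv_add_smul hU hA.smooth_vol (hA.smooth_field 2) (hA.smooth_field 3) hx
      (lam k)).trans ?_
    rw [hA.div_free 2 x hx, hA.div_free 3 x hx, mul_zero, add_zero]
  have h := sum_coordPartial_bivector_eq_zero hU hφs hJ hA.smooth_vol hX hY hx hdX hdY
    (hA.commute (lam k) x hx) l
  have hterm : ∀ m, coordPartial φ m (fun z => f z / (jacobian φ z).det *
      (applyVF (laxY A (lam k)) (φ l) z * applyVF (laxX A (lam k)) (φ m) z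
        - applyVF (laxX A (lam k)) (φ l) z * applyVF (laxY A (lam k)) (φ m) z)) x
      = (lam k - lam l) * ((lam k - lam m) * coordPartial φ m (coeffA A f φ l m) x) := by
    intro m
    rw [← mul_assoc, ← coordPartial_const_mul ((contDiffOn_coeffA hU hA.smooth_field hA.smooth_vol
      hφs hJ l m).differentiableAt_of_isOpen hU hx)]
    refine coordPartial_congr hU hx (fun z hz => ?_) m
    rw [(hφ l).applyVF_laxX hz, (hφ m).applyVF_laxX hz, (hφ l).applyVF_laxY hz,
      (hφ m).applyVF_laxY hz, coeffA, tildeA]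
    ring
  rw [Finset.sum_congr rfl fun m _ => hterm m, ← Finset.mul_sum] at h
  exact (mul_eq_zero.1 h).resolve_left (sub_ne_zero.2 fun h' => hkl (hlam h'))

theorem contDiffOn_mixedCoeff (hA : IsSelfDualEinstein U A f) (hU : IsOpen U)
    (hφ : ∀ i, ContDiffOn 𝕜 ∞ (φ i) U) (hJ : ∀ x ∈ U, (jacobian φ x).det ≠ 0) (i k : Fin 4) :
    ContDiffOn 𝕜 ∞ (mixedCoeff A f lam φ i k) U :=
  (contDiffOn_const.mul (ContDiffOn.sum fun l _ => ContDiffOn.sum fun m _ => contDiffOn_const.mul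
    (contDiffOn_coeffA hU hA.smooth_field hA.smooth_vol hφ hJ l m))).div_const _

/-- Let `l` be the fourth index. In the divergence identity for `k, l`, the term `m = l` vanishes by
antisymmetry and `m = k` by its factor `lam k - lam k`. The two surviving terms are the two sides,
up to sign and a common factor. -/
theorem IsSelfDualEinstein.coordPartial_mixedCoeff_comm (hA : IsSelfDualEinstein U A f)
    (hU : IsOpen U) (hlam : Function.Injective lam)
    (hφ : ∀ i, IsEigenfunction A U (lam i) (φ i)) (hJ : ∀ x ∈ U, (jacobian φ x).det ≠ 0)
    (hx : x ∈ U) {i j k : Fin 4} (hik : i ≠ k) (hjk : j ≠ k) :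
    coordPartial φ j (mixedCoeff A f lam φ i k) x
      = coordPartial φ i (mixedCoeff A f lam φ j k) x := by
  by_cases hij : i = j
  · rw [hij]
  obtain ⟨l, hl, hl', hkl⟩ : ∃ l, [i, k, l, j].Nodup ∧ [j, k, l, i].Nodup ∧ k ≠ l := by
    revert i j k; decide
  have formula : ∀ {i j : Fin 4}, [i, k, l, j].Nodup → coordPartial φ j (mixedCoeff A f lam φ i k) x
      = 1 / 2 * (leviCivita i k l j : 𝕜) / (lam k - lam i)
        * coordPartial φ j (coeffA A f φ l j) x := by
    intro i j h
    rw [← coordPartial_const_mul ((contDiffOn_coeffA hU hA.smooth_field hA.smooth_vol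
      (fun i => (hφ i).smooth) hJ l j).differentiableAt_of_isOpen hU hx)]
    refine coordPartial_congr hU hx (fun z _ => ?_) j
    rw [mixedCoeff, dualCoeff_eq h]
    ring
  have hsum := hA.sum_coordPartial_coeffA hU hlam hφ hJ hx hkl
  have huniv : (Finset.univ : Finset (Fin 4)) = {i, k, l, j} := by
    have : ∀ {i j k l : Fin 4}, [i, k, l, j].Nodup → Finset.univ = ({i, k, l, j} : Finset (Fin 4)) := by
      decide
    exact this hl
  have hself : coordPartial φ l (coeffA A f φ l l) x = 0 := by
    have : coeffA A f φ l l = fun _ => 0 := funext fun z => coeffA_self l z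
    rw [this, coordPartial_eq, fderiv_fun_const]
    simp
  simp only [List.nodup_cons, List.mem_cons, List.not_mem_nil, not_or, or_false] at hl
  rw [huniv, Finset.sum_insert (by simp; tauto), Finset.sum_insert (by simp; tauto),
    Finset.sum_insert (by simp; tauto), Finset.sum_singleton, hself] at hsum
  rw [formula (by simpa using hl), formula hl', leviCivita_swap_outer i k l j]
  have hi : lam k - lam i ≠ 0 := sub_ne_zero.2 fun h => hik (hlam h).symm
  have hj : lam k - lam j ≠ 0 := sub_ne_zero.2 fun h => hjk (hlam h).symm
  push_cast
  field_simp
  linear_combination (leviCivita i k l j : 𝕜) * hsum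

/-! ### Factorisations and potentials -/

theorem exists_isFactorisation (hA : IsSelfDualEinstein U A f) (hU : IsOpen U)
    (hlam : Function.Injective lam) (hφ : ∀ i, IsEigenfunction A U (lam i) (φ i))
    (hJ : ∀ x ∈ U, (jacobian φ x).det ≠ 0) {p : Fin 4 → 𝕜} (hp : p ∈ U) :
    ∃ V : Set (Fin 4 → 𝕜), IsOpen V ∧ p ∈ V ∧ V ⊆ U ∧
      ∃ ψ : Fin 4 → (Fin 4 → 𝕜) → 𝕜, IsFactorisation A f lam φ V ψ := by
  have hφs := fun i => (hφ i).smooth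
  choose V hV hpV hVU ψ hψ hdψ using fun k => exists_partial_primitive hU hφs hJ k
    (S := fun i => mixedCoeff A f lam φ i k) (contDiffOn_mixedCoeff hA hU hφs hJ · k)
    (fun x hx i j hi hj => hA.coordPartial_mixedCoeff_comm hU hlam hφ hJ hx hi hj) hp
  refine ⟨⋂ k, V k, isOpen_iInter_of_finite hV, Set.mem_iInter.2 hpV,
    (Set.iInter_subset V 0).trans (hVU 0), ψ, fun k => (hψ k).mono (Set.iInter_subset V k),
    fun k x hx => ?_⟩
  have hxk := Set.mem_iInter.1 hx k
  exact (Omega_eq_wedge_iff (hJ x (hVU k hxk)) k (ψ k)).2 (hdψ k x hxk)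

variable {V : Set (Fin 4 → 𝕜)} {ψ : Fin 4 → (Fin 4 → 𝕜) → 𝕜}

theorem IsFactorisation.coordPartial_eq (hψ : IsFactorisation A f lam φ V ψ)
    (hJ : ∀ x ∈ V, (jacobian φ x).det ≠ 0) (hx : x ∈ V) {i k : Fin 4} (hik : i ≠ k) :
    coordPartial φ i (ψ k) x = mixedCoeff A f lam φ i k x :=
  (Omega_eq_wedge_iff (hJ x hx) k (ψ k)).1 (hψ.eq_wedge k x hx) i hik

/-- By the chain rule the factor `lam k - lam i` from the Lax operator cancels the denominator of
`∂ᵢψ_k`, leaving the dual contracted with a factor of the bivector. The unknown `∂ₖψ_k` is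
multiplied by zero. -/
theorem IsFactorisation.isEigenfunction (hψ : IsFactorisation A f lam φ V ψ)
    (hlam : Function.Injective lam) (hφ : ∀ i, IsEigenfunction A U (lam i) (φ i)) (hVU : V ⊆ U)
    (hJ : ∀ x ∈ V, (jacobian φ x).det ≠ 0) (k : Fin 4) :
    IsEigenfunction A V (lam k) (ψ k) := by
  have key : ∀ x ∈ V, ∀ (X B : (Fin 4 → 𝕜) → (Fin 4 → 𝕜)),
      (∀ i, applyVF X (φ i) x = (lam k - lam i) * applyVF B (φ i) x) →
      ∑ i, dualCoeff A f φ i k x * applyVF B (φ i) x = 0 → applyVF X (ψ k) x = 0 := by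
    intro x hx X B hX hB
    rw [applyVF_eq_sum (hJ x hx), ← hB]
    refine Finset.sum_congr rfl fun i _ => ?_
    rw [hX, ← sub_mul_mixedCoeff hlam]
    by_cases hik : i = k
    · subst hik; ring
    · rw [hψ.coordPartial_eq hJ hx hik]; ring
  exact ⟨hψ.smooth k,
    fun x hx => key x hx _ (A 1) (fun i => (hφ i).applyVF_laxX (hVU hx) _)
      (sum_dualCoeff_mul_eq_zero k x).1,
    fun x hx => key x hx _ (A 3) (fun i => (hφ i).applyVF_laxY (hVU hx) _)
      (sum_dualCoeff_mul_eq_zero k x).2⟩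

/-- A quotient of two antisymmetric quantities is symmetric; this is the closedness of `∑ ψ_k dφᵏ`.
-/
theorem IsFactorisation.coordPartial_comm (hψ : IsFactorisation A f lam φ V ψ)
    (hJ : ∀ x ∈ V, (jacobian φ x).det ≠ 0) (hx : x ∈ V) (i k : Fin 4) :
    coordPartial φ i (ψ k) x = coordPartial φ k (ψ i) x := by
  by_cases hik : i = k
  · rw [hik]
  · rw [hψ.coordPartial_eq hJ hx hik, hψ.coordPartial_eq hJ hx (Ne.symm hik), mixedCoeff_swap]

/-- A smooth function is a potential exactly when its mixed second derivatives are the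
coefficients of the `Ω_k`. -/
theorem isHeavenlyPotential_iff (hlam : Function.Injective lam) (hV : IsOpen V)
    (hφ : ∀ i, ContDiffOn 𝕜 ∞ (φ i) V) (hJ : ∀ x ∈ V, (jacobian φ x).det ≠ 0)
    {Θ : (Fin 4 → 𝕜) → 𝕜} (hΘ : ContDiffOn 𝕜 ∞ Θ V) :
    IsHeavenlyPotential A f lam φ V Θ ↔
      ∀ x ∈ V, ∀ i k, i ≠ k → coordPartial₂ φ i k Θ x = mixedCoeff A f lam φ i k x := by
  have hanti : ∀ x ∈ V, ∀ i k, (lam i - lam k) * coordPartial₂ φ k i Θ x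
      = -((lam k - lam i) * coordPartial₂ φ i k Θ x) := by
    intro x hx i k
    rw [coordPartial₂_comm hV hφ hJ hΘ hx k i]
    ring
  constructor
  · intro h x hx i k hik
    have h1 := (coeffA_eq_iff_dualCoeff_eq (hanti x hx)).1 (fun l m => h.coeff_eq l m x hx) i k
    rw [← sub_mul_mixedCoeff hlam] at h1
    exact mul_left_cancel₀ (sub_ne_zero.2 fun h' => hik (hlam h').symm) h1
  · refine fun h => ⟨hΘ, fun l m x hx => (coeffA_eq_iff_dualCoeff_eq (hanti x hx)).2
      (fun i k => ?_) l m⟩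
    rw [← sub_mul_mixedCoeff hlam]
    by_cases hik : i = k
    · subst hik; ring
    · rw [h x hx i k hik]

/-- This is the Plücker relation with `ω_{ik} = (lam k - lam i) Θ_{yⁱyᵏ}` inserted; the sign
reversals occur in pairs. -/
theorem satisfiesGeneralHeavenly_of_mixedCoeff (hlam : Function.Injective lam)
    {Θ : (Fin 4 → 𝕜) → 𝕜}
    (h : ∀ x ∈ V, ∀ i k, i ≠ k → coordPartial₂ φ i k Θ x = mixedCoeff A f lam φ i k x) :
    SatisfiesGeneralHeavenly lam φ V Θ := by
  intro x hx
  have hP := plucker_dualCoeff (A := A) (f := f) (φ := φ) x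
  simp only [← sub_mul_mixedCoeff hlam] at hP
  rw [h x hx 0 1 (by decide), h x hx 2 3 (by decide), h x hx 1 2 (by decide),
    h x hx 0 3 (by decide), h x hx 2 0 (by decide), h x hx 1 3 (by decide)]
  linear_combination hP

end SelfDual

/-! ### The main theorem -/

theorem theorem4 {𝕜 : Type*} [RCLike 𝕜]
    (U : Set (Fin 4 → 𝕜)) (hU : IsOpen U)
    (A : Fin 4 → (Fin 4 → 𝕜) → (Fin 4 → 𝕜)) (f : (Fin 4 → 𝕜) → 𝕜)
    (hA : SelfDual.IsSelfDualEinstein U A f)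
    (lam : Fin 4 → 𝕜) (hlam : Function.Injective lam)
    (φ : Fin 4 → (Fin 4 → 𝕜) → 𝕜)
    (hφ : ∀ i, SelfDual.IsEigenfunction A U (lam i) (φ i))
    (hJ : ∀ x ∈ U, (SelfDual.jacobian φ x).det ≠ 0) :
    -- near every point there are functions with `Ω_k = dψ_k ∧ dφᵏ`
    (∀ p ∈ U, ∃ V : Set (Fin 4 → 𝕜), IsOpen V ∧ p ∈ V ∧ V ⊆ U ∧
      ∃ ψ : Fin 4 → (Fin 4 → 𝕜) → 𝕜, SelfDual.IsFactorisation A f lam φ V ψ) ∧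
    -- all such functions are eigenfunctions and give rise to a potential
    (∀ V : Set (Fin 4 → 𝕜), IsOpen V → V ⊆ U →
      ∀ ψ : Fin 4 → (Fin 4 → 𝕜) → 𝕜, SelfDual.IsFactorisation A f lam φ V ψ →
        (∀ k, SelfDual.IsEigenfunction A V (lam k) (ψ k)) ∧
        (∀ p ∈ V, ∃ W : Set (Fin 4 → 𝕜), IsOpen W ∧ p ∈ W ∧ W ⊆ V ∧
          ∃ Θ : (Fin 4 → 𝕜) → 𝕜, SelfDual.IsPrimitive φ ψ W Θ) ∧
        (∀ W : Set (Fin 4 → 𝕜), IsOpen W → W ⊆ V →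
          ∀ Θ : (Fin 4 → 𝕜) → 𝕜, SelfDual.IsPrimitive φ ψ W Θ →
            (∀ k, ∀ x ∈ W, SelfDual.coordPartial φ k Θ x = ψ k x) ∧
            SelfDual.IsHeavenlyPotential A f lam φ W Θ ∧
            SelfDual.SatisfiesGeneralHeavenly lam φ W Θ)) ∧
    -- conversely, every potential of the general heavenly equation arises in this way
    (∀ V : Set (Fin 4 → 𝕜), IsOpen V → V ⊆ U →
      ∀ Θ : (Fin 4 → 𝕜) → 𝕜, SelfDual.IsHeavenlyPotential A f lam φ V Θ →
        SelfDual.IsFactorisation A f lam φ V (fun k => SelfDual.coordPartial φ k Θ) ∧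
        SelfDual.IsPrimitive φ (fun k => SelfDual.coordPartial φ k Θ) V Θ) := by
  have hφs := fun i => (hφ i).smooth
  refine ⟨fun p hp => SelfDual.exists_isFactorisation hA hU hlam hφ hJ hp,
    fun V hV hVU ψ hψ => ?_, fun V hV hVU Θ hΘ => ?_⟩
  · have hJV : ∀ x ∈ V, (SelfDual.jacobian φ x).det ≠ 0 := fun x hx => hJ x (hVU hx)
    refine ⟨hψ.isEigenfunction hlam hφ hVU hJV,
      fun p hp => SelfDual.exists_isPrimitive hV (fun i => (hφs i).mono hVU) hψ.smooth hJV
        (fun x hx => hψ.coordPartial_comm hJV hx) hp, fun W hW hWV Θ hΘ => ?_⟩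
    have hJW : ∀ x ∈ W, (SelfDual.jacobian φ x).det ≠ 0 := fun x hx => hJV x (hWV hx)
    have hfirst : ∀ k, ∀ x ∈ W, SelfDual.coordPartial φ k Θ x = ψ k x := fun k x hx =>
      SelfDual.coordPartial_eq_of_fderiv_eq (hJW x hx) (hΘ.d_eq x hx) k
    have hsecond : ∀ x ∈ W, ∀ i k, i ≠ k →
        SelfDual.coordPartial₂ φ i k Θ x = SelfDual.mixedCoeff A f lam φ i k x := by
      intro x hx i k hik
      rw [SelfDual.coordPartial₂, SelfDual.coordPartial_congr hW hx (hfirst i) k,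
        hψ.coordPartial_eq hJV (hWV hx) (Ne.symm hik), SelfDual.mixedCoeff_swap]
    exact ⟨hfirst, (SelfDual.isHeavenlyPotential_iff hlam hW
      (fun i => (hφs i).mono (hWV.trans hVU)) hJW hΘ.smooth).2 hsecond,
      SelfDual.satisfiesGeneralHeavenly_of_mixedCoeff hlam hsecond⟩
  · have hJV : ∀ x ∈ V, (SelfDual.jacobian φ x).det ≠ 0 := fun x hx => hJ x (hVU hx)
    have hφV := fun i => (hφs i).mono hVU
    have hsecond := (SelfDual.isHeavenlyPotential_iff hlam hV hφV hJV hΘ.smooth).1 hΘ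
    refine ⟨⟨fun k => SelfDual.contDiffOn_coordPartial hV hφV hJV k hΘ.smooth,
      fun k x hx => (SelfDual.Omega_eq_wedge_iff (hJV x hx) k _).2 fun i hik => ?_⟩,
      hΘ.smooth, fun x hx => SelfDual.fderiv_eq_sum_coordPartial (hJV x hx) Θ⟩
    rw [← SelfDual.mixedCoeff_swap]
    exact hsecond x hx k i (Ne.symm hik)
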